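/- **Setting.** A dataset is a tuple $\mathcal D=(\mathbf x_i,y_i)_{i=1}^k$ with points $\mathbf x_i\in\{\pm1\}^n$ (not necessarily distinct) and labels $y_i\in\{\pm1\}$. Let $\mathcal H(\mathcal D)$ be the finite set of all homogeneous halfspaces $h(\mathbf x)=\operatorname{sign}(\mathbf w\cdot\mathbf x)$, $\mathbf w\in\mathbb R^n$, $\operatorname{sign}(0)=1$, with $h(\mathbf x_i)=y_i$ for all $i$; only datasets with $\mathcal H(\mathcal D)\neq\emptyset$ are considered. For a probability distribution $\mathcal H$ on $\mathcal H(\mathcal D)$ put $c(\mathcal H)=|\mathcal H(\mathcal D)|\sum_{h}\Pr(h)^2$. Write $\langle f,g\rangle=2^{-n}\sum_{\mathbf x\in\{\pm1\}^n}f(\mathbf x)g(\mathbf x)$, $d(f,g)=2^{-n}\sum_{\mathbf x}\frac{1-f(\mathbf x)g(\mathbf x)}2$, and let $\mathbb E_{h_1,h_2}\langle h_1,h_2\rangle$ and the expected diameter $\mathbb E_{h_1,h_2}d(h_1,h_2)$ be the expectations over independent $h_1,h_2\sim\mathcal H$. For $S\subseteq[n]$ let $\chi_S(\mathbf x)=\prod_{j\in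 S}x_j$ and $\ell(S)=\frac1k\sum_{i=1}^k\chi_S(\mathbf x_i)y_i$. A property holds *for most datasets* (with given $n,k$) if (i) for all but at most a fraction $e^{-n}$ of the tuples $(\mathbf x_1,\dots,\mathbf x_k)\in(\{\pm1\}^n)^k$ it holds for every labelling of the tuple that has a consistent halfspace, and (ii) it fails for at most a fraction $e^{-n}$ of all labelled datasets that have a consistent halfspace. **Theorem.** 1. There is an absolute constant $C>0$ such that for every integer $a\ge1$ and all real $\lambda,\kappa>0$ there are a sequence $\mathrm{err}(n)\to0$ and an $N$ such that for all $n\ge N$ and all $k\ge\kappa\,n^{2a+2+\lambda}$, most datasets $\mathcal D$ satisfy, for every probability distribution $\mathcal H$ on $\mathcal H(\mathcal D)$, $$\mathbb E_{h_1,h_2}\langle h_1,h_2\rangle-\frac{C\,c(\mathcal H)}{\sqrt a}-\mathrm{err}(n)\;\le\;\sum_{|S|<a}\ell(S)^2\;\le\;\mathbb E_{h_1,h_2}\langle h_1,h_2\rangle+\mathrm{err}(n).$$ 2. For all constants $c,\varepsilon>0$ there is an integer $a\ge1$ such that $A(\mathcal D)=\sum_{|S|<a}\ell(S)^2$ is computed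 exactly from $\mathcal D$ alone (for $k\ge1$), as a quotient of two integers, by a deterministic random access machine (unit-cost steps, integer addition and subtraction, no multiplication) in time polynomial in $n+k$; and for all $\lambda,\kappa>0$ there is an $N$ such that for all $n\ge N$ and $k\ge\kappa\,n^{2a+2+\lambda}$, most datasets $\mathcal D$ satisfy, for every distribution $\mathcal H$ on $\mathcal H(\mathcal D)$ with $c(\mathcal H)\le c$, $$\Bigl|A(\mathcal D)-\mathbb E_{h_1,h_2}\langle h_1,h_2\rangle\Bigr|\le\varepsilon\quad\text{and}\quad\Bigl|\tfrac{1-A(\mathcal D)}2-\mathbb E_{h_1,h_2}d(h_1,h_2)\Bigr|\le\varepsilon .$$ In particular, polynomially many points and time polynomial in $n$ suffice. 3. The uniform distribution on $\mathcal H(\mathcal D)\ne\emptyset$ has $c(\mathcal H_{uni})=1$. -/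

import Mathlib

namespace ExpectedDiameter

open scoped BigOperators

/-! ### Boolean data, halfspaces and consistent hypotheses -/

/-- The hypercube `{±1}^n`; the two-element set `{±1}` is the group of units of `ℤ`. -/
abbrev Cube (n : ℕ) : Type := Fin n → ℤˣ

/-- The real number `1` or `-1` given by a sign. -/
def toReal (u : ℤˣ) : ℝ := ((u : ℤ) : ℝ)

/-- A dataset of `k` labelled points of `{±1}^n`: the tuple of points (repetitions allowed)
and the tuple of labels. -/
abbrev Dataset (n k : ℕ) : Type := (Fin k → Cube n) × (Fin k → ℤˣ)

/-- A homogeneous halfspace `h(x) = sign(w · x)`, with `sign 0 = 1`. -/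
def IsHalfspace {n : ℕ} (h : Cube n → ℤˣ) : Prop :=
  ∃ w : Fin n → ℝ, ∀ x : Cube n, (h x = 1 ↔ 0 ≤ ∑ j, w j * toReal (x j))

/-- The set of consistent hypotheses of a dataset: all halfspaces that agree with its labels. -/
def consistent {n k : ℕ} (D : Dataset n k) : Set (Cube n → ℤˣ) :=
  {h | IsHalfspace h ∧ ∀ i, h (D.1 i) = D.2 i}

/-! ### Distributions on a set of hypotheses -/

/-- `p` is the weight function of a probability distribution on the finite set `H`. -/
structure IsDistributionOn {n : ℕ} (H : Set (Cube n → ℤˣ)) (p : (Cube n → ℤˣ) → ℝ) : Prop where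
  nonneg : ∀ h, 0 ≤ p h
  support : ∀ h, h ∉ H → p h = 0
  total : ∑ h, p h = 1

open Classical in
/-- The weights of the uniform distribution on `H`. -/
noncomputable def uniformOn {n : ℕ} (H : Set (Cube n → ℤˣ)) (h : Cube n → ℤˣ) : ℝ :=
  if h ∈ H then 1 / (H.ncard : ℝ) else 0

/-- The parameter `c = |H| ∑ₕ Pr(h)²` of a distribution on `H`. -/
noncomputable def concentration {n : ℕ} (H : Set (Cube n → ℤˣ)) (p : (Cube n → ℤˣ) → ℝ) : ℝ :=
  (H.ncard : ℝ) * ∑ h, p h ^ 2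

/-- The inner product `⟨f, g⟩ = E_x f(x) g(x)` for `x` uniform in `{±1}^n`. -/
noncomputable def innerProd {n : ℕ} (f g : Cube n → ℤˣ) : ℝ :=
  (1 / 2 ^ n) * ∑ x : Cube n, toReal (f x) * toReal (g x)

/-- `E ⟨h₁, h₂⟩` for independent `h₁, h₂` of law `p`. -/
noncomputable def expectedInner {n : ℕ} (p : (Cube n → ℤˣ) → ℝ) : ℝ :=
  ∑ h₁, ∑ h₂, p h₁ * p h₂ * innerProd h₁ h₂

/-- The distance `d(f, g)`, the fraction of points where `f` and `g` disagree. -/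
noncomputable def dist {n : ℕ} (f g : Cube n → ℤˣ) : ℝ :=
  (1 / 2 ^ n) * ∑ x : Cube n, (1 - toReal (f x) * toReal (g x)) / 2

/-- The expected diameter `E d(h₁, h₂)` for independent `h₁, h₂` of law `p`. -/
noncomputable def expectedDiameter {n : ℕ} (p : (Cube n → ℤˣ) → ℝ) : ℝ :=
  ∑ h₁, ∑ h₂, p h₁ * p h₂ * dist h₁ h₂

/-! ### Empirical Fourier coefficients -/

/-- The character `χ_S(x) = ∏_{j ∈ S} x_j`. -/
def character {n : ℕ} (S : Finset (Fin n)) (x : Cube n) : ℝ := ∏ j ∈ S, toReal (x j)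

/-- The empirical correlation `ℓ(S) = (1/k) ∑ᵢ χ_S(xᵢ) yᵢ`. -/
noncomputable def empirical {n k : ℕ} (D : Dataset n k) (S : Finset (Fin n)) : ℝ :=
  (1 / (k : ℝ)) * ∑ i, character S (D.1 i) * toReal (D.2 i)

/-- The estimator `∑_{|S| < a} ℓ(S)²`. -/
noncomputable def estimator {n k : ℕ} (a : ℕ) (D : Dataset n k) : ℝ :=
  ∑ S : Finset (Fin n) with S.card < a, empirical D S ^ 2

/-! ### All but an exponentially small fraction of datasets -/

/-- `Q` holds for all but a fraction `exp(-n)` of the datasets with `k` points in `{±1}^n` that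
have a consistent hypothesis, in both senses of the word: only a fraction `exp(-n)` of the
`k`-tuples of points can be labelled consistently so that `Q` fails, and `Q` fails for
only a fraction `exp(-n)` of the consistently labelled datasets. -/
def ForMostDatasets (n k : ℕ) (Q : Dataset n k → Prop) : Prop :=
  ((({X : Fin k → Cube n | ∃ y, (consistent (X, y)).Nonempty ∧ ¬ Q (X, y)}).ncard : ℝ)
      ≤ Real.exp (-(n : ℝ)) * (Set.univ : Set (Fin k → Cube n)).ncard) ∧
  ((({D : Dataset n k | (consistent D).Nonempty ∧ ¬ Q D}).ncard : ℝ)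
      ≤ Real.exp (-(n : ℝ)) * ({D : Dataset n k | (consistent D).Nonempty}).ncard)

/-! ### Random access machines with unit-cost steps

There is no multiplication instruction, so integers grow by at most one bit per
step and unit cost is polynomially equivalent to Turing machine time. -/

/-- A state: integer registers and an integer memory. -/
structure RamState where
  reg : ℕ → ℤ
  mem : ℕ → ℤ

/-- Programs of the machine. -/
inductive Prog : Type
  /-- `reg r := c` -/
  | const (r : ℕ) (c : ℤ)
  /-- `reg r := reg s + reg t` -/
  | add (r s t : ℕ)
  /-- `reg r := reg s - reg t` -/
  | sub (r s t : ℕ)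
  /-- `reg r := mem[reg s]` -/
  | load (r s : ℕ)
  /-- `mem[reg r] := reg s` -/
  | store (r s : ℕ)
  /-- run `P`, then `Q` -/
  | seq (P Q : Prog)
  /-- if `reg r > 0` run `P`, else run `Q` -/
  | ifPos (r : ℕ) (P Q : Prog)
  /-- while `reg r > 0` run `P` -/
  | whilePos (r : ℕ) (P : Prog)

/-- `Exec P s t s'`: started in state `s`, the program `P` halts after exactly `t` steps in
state `s'`. Every basic instruction and every test of a register is one step. A negative
address is read as address `0`. -/
inductive Exec : Prog → RamState → ℕ → RamState → Prop
  | const (r : ℕ) (c : ℤ) (s : RamState) :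
      Exec (.const r c) s 1 ⟨Function.update s.reg r c, s.mem⟩
  | add (r i j : ℕ) (s : RamState) :
      Exec (.add r i j) s 1 ⟨Function.update s.reg r (s.reg i + s.reg j), s.mem⟩
  | sub (r i j : ℕ) (s : RamState) :
      Exec (.sub r i j) s 1 ⟨Function.update s.reg r (s.reg i - s.reg j), s.mem⟩
  | load (r i : ℕ) (s : RamState) :
      Exec (.load r i) s 1 ⟨Function.update s.reg r (s.mem (s.reg i).toNat), s.mem⟩
  | store (r i : ℕ) (s : RamState) :
      Exec (.store r i) s 1 ⟨s.reg, Function.update s.mem (s.reg r).toNat (s.reg i)⟩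
  | seq {P Q : Prog} {s s' s'' : RamState} {t t' : ℕ} :
      Exec P s t s' → Exec Q s' t' s'' → Exec (.seq P Q) s (t + t') s''
  | ifPos_true {r : ℕ} {P Q : Prog} {s s' : RamState} {t : ℕ} :
      0 < s.reg r → Exec P s t s' → Exec (.ifPos r P Q) s (t + 1) s'
  | ifPos_false {r : ℕ} {P Q : Prog} {s s' : RamState} {t : ℕ} :
      ¬ 0 < s.reg r → Exec Q s t s' → Exec (.ifPos r P Q) s (t + 1) s'
  | while_true {r : ℕ} {P : Prog} {s s' s'' : RamState} {t t' : ℕ} :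
      0 < s.reg r → Exec P s t s' → Exec (.whilePos r P) s' t' s'' →
      Exec (.whilePos r P) s (t + t' + 1) s''
  | while_false {r : ℕ} {P : Prog} {s : RamState} :
      ¬ 0 < s.reg r → Exec (.whilePos r P) s 1 s

/-- The initial state for a dataset: registers `0` and `1` hold `n` and `k`; the memory holds
the rows `xᵢ₁, …, xᵢₙ, yᵢ` one after the other; everything else is `0`. -/
def inputState {n k : ℕ} (D : Dataset n k) : RamState where
  reg r := if r = 0 then (n : ℤ) else if r = 1 then (k : ℤ) else 0
  mem m :=
    if hi : m / (n + 1) < k then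
      if hj : m % (n + 1) < n then ((D.1 ⟨m / (n + 1), hi⟩ ⟨m % (n + 1), hj⟩ : ℤˣ) : ℤ)
      else ((D.2 ⟨m / (n + 1), hi⟩ : ℤˣ) : ℤ)
    else 0

/-- `P` computes the real-valued function `f` of nonempty datasets within `T(n + k)` steps: it
halts with `f D` as the quotient of register `0` by the positive register `1`. -/
def ComputesWithin (P : Prog) (T : Polynomial ℕ) (f : ∀ n k : ℕ, Dataset n k → ℝ) : Prop :=
  ∀ (n k : ℕ) (D : Dataset n k), 0 < k →
    ∃ (t : ℕ) (s : RamState), Exec P (inputState D) t s ∧ t ≤ T.eval (n + k) ∧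
      0 < s.reg 1 ∧ (s.reg 0 : ℝ) / (s.reg 1 : ℝ) = f n k D

end ExpectedDiameter

open ExpectedDiameter Filter Topology

/-! By Parseval, `E ⟨h₁, h₂⟩ = ∑_S (E_h ĥ(S))²`, so it is enough to estimate the mean coefficients
`E_h ĥ(S)` at low levels and to bound the weight at the levels `|S| ≥ a`.

Tail. A halfspace is monotone or antitone in each coordinate, so its total influence in `m`
variables is at most `√m`. Split the `n` coordinates randomly into `m = 2a` blocks. As a function of
the block signs the halfspace is again a halfspace, so the probabilities that flipping a block
changes its value add up to at most `√m`. In Fourier terms, averaging over partitions gives `m ∑_S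
(1 - (1 - 2/m)^|S|) ĥ(S)² ≤ 2√m`, and the factor in brackets is at least `1/2` once `|S| ≥ a`. Hence
the tail is at most `3/√a` (`IsHalfspace.fourier_tail_le`), and by Jensen the same holds for
mixtures. The parameter `c` plays no role in this bound; it enters the final estimate only through
`1 ≤ c`.

Sampling. Chow parameters show that there are only `2^O(n²)` halfspaces. A Chernoff bound and a
union bound over halfspaces and sets `S` make all empirical coefficients `δ`-accurate at once on
most samples, as soon as `k δ² ≥ 160 n²` (`ForMostDatasets.of_representative`). Every consistent `h`
reproduces the labels, so `ℓ(S)` is close to every such `ĥ(S)` and to any average of them. With `δ =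
n^(-(a + λ/4))` the error over the at most `n^a` low sets is `3 n^(-λ/4)`.

Computation. Expanding the squares, `k²` times the estimator is the sum over pairs of rows of `y_i
y_j ∑_{t<a} e_t(x_i x_j)`, with `e_t` the elementary symmetric polynomials. Their recurrence only
multiplies by signs, so additions and subtractions suffice. -/

namespace ExpectedDiameter

/-! ### Signs and characters -/

theorem toReal_mul (u v : ℤˣ) : toReal (u * v) = toReal u * toReal v := by
  simp [toReal]

@[simp] theorem toReal_one : toReal 1 = 1 := by simp [toReal]

@[simp] theorem toReal_neg_one : toReal (-1) = -1 := by simp [toReal]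

theorem toReal_eq_or (u : ℤˣ) : toReal u = 1 ∨ toReal u = -1 := by
  rcases Int.units_eq_one_or u with rfl | rfl <;> simp

theorem toReal_mul_self (u : ℤˣ) : toReal u * toReal u = 1 := by
  rcases toReal_eq_or u with h | h <;> rw [h] <;> norm_num

theorem abs_toReal (u : ℤˣ) : |toReal u| = 1 := by
  rcases toReal_eq_or u with h | h <;> rw [h] <;> norm_num

theorem card_cube (n : ℕ) : Fintype.card (Cube n) = 2 ^ n := by
  simp [Fintype.card_units_int]

variable {n : ℕ}

theorem character_mul (S : Finset (Fin n)) (x y : Cube n) :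
    character S (x * y) = character S x * character S y := by
  simp [character, toReal_mul, Finset.prod_mul_distrib]

theorem abs_character (S : Finset (Fin n)) (x : Cube n) : |character S x| = 1 := by
  simp [character, Finset.abs_prod, abs_toReal]

theorem character_mul_self (S : Finset (Fin n)) (x : Cube n) :
    character S x * character S x = 1 := by
  rw [← abs_mul_abs_self, abs_character, one_mul]

/-- The sum factors as `∏_j (1 + x_j y_j)`, and a coordinate where the points differ contributes the
factor `0`. -/
theorem sum_character_mul_character (x y : Cube n) :
    ∑ S, character S x * character S y = if x = y then 2 ^ n else 0 := by
  simp_rw [← character_mul]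
  have key : ∑ S, character S (x * y) = ∏ j, (1 + toReal ((x * y) j)) := by
    rw [Finset.prod_one_add, Finset.powerset_univ]
    rfl
  rw [key]
  split_ifs with h
  · subst h
    have : ∀ j, 1 + toReal ((x * x) j) = 2 := fun j => by
      rw [Pi.mul_apply, toReal_mul, toReal_mul_self]; norm_num
    simp only [this, Finset.prod_const, Finset.card_univ, Fintype.card_fin]
  · obtain ⟨j, hj⟩ := Function.ne_iff.1 h
    refine Finset.prod_eq_zero (Finset.mem_univ j) ?_
    rw [Pi.mul_apply]
    rcases Int.units_eq_one_or (x j) with hx | hx <;> rcases Int.units_eq_one_or (y j) with hy | hy <;>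
      simp_all

/-! ### Fourier coefficients -/

/-- The Fourier coefficient `E_x f(x) χ_S(x)`. -/
noncomputable def fourier (f : Cube n → ℝ) (S : Finset (Fin n)) : ℝ :=
  (1 / 2 ^ n) * ∑ x, f x * character S x

/-- Expand both coefficients and sum over `S` first: by `sum_character_mul_character` only the
diagonal `x = y` survives. -/
theorem parseval (f g : Cube n → ℝ) :
    ∑ S, fourier f S * fourier g S = (1 / 2 ^ n) * ∑ x, f x * g x := by
  have h : ∀ S, fourier f S * fourier g S =
      (1 / 2 ^ n) ^ 2 * ∑ x, ∑ y, f x * g y * (character S x * character S y) := fun S => by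
    unfold fourier
    rw [mul_mul_mul_comm, Finset.sum_mul_sum, ← sq]
    congr 1
    exact Finset.sum_congr rfl fun x _ => Finset.sum_congr rfl fun y _ => by ring
  simp_rw [h, ← Finset.mul_sum]
  rw [Finset.sum_comm]
  simp_rw [Finset.sum_comm (s := (Finset.univ : Finset (Finset (Fin n)))), ← Finset.mul_sum,
    sum_character_mul_character]
  simp only [mul_ite, mul_zero, Finset.sum_ite_eq, Finset.mem_univ, if_true]
  rw [← Finset.sum_mul]
  field_simp

theorem fourier_translate (f : Cube n → ℝ) (u : Cube n) (S : Finset (Fin n)) :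
    fourier (fun x => f (x * u)) S = character S u * fourier f S := by
  unfold fourier
  rw [mul_left_comm]
  congr 1
  rw [Finset.mul_sum, ← Equiv.sum_comp (Equiv.mulRight u) fun x => character S u * (f x * character S x)]
  refine Finset.sum_congr rfl fun x _ => ?_
  rw [Equiv.coe_mulRight, character_mul]
  linear_combination (-f (x * u) * character S x) * character_mul_self S u

theorem abs_fourier_le (f : Cube n → ℝ) (hf : ∀ x, |f x| ≤ 1) (S : Finset (Fin n)) :
    |fourier f S| ≤ 1 := by
  have h : |∑ x, f x * character S x| ≤ 2 ^ n := by
    refine (Finset.abs_sum_le_sum_abs _ _).trans ?_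
    refine (Finset.sum_le_sum (g := fun _ => (1 : ℝ)) fun x _ => ?_).trans ?_
    · rw [abs_mul, abs_character, mul_one]; exact hf x
    · simp [Fintype.card_units_int]
  rw [fourier, abs_mul, abs_of_pos (by positivity : (0 : ℝ) < 1 / 2 ^ n), one_div,
    inv_mul_le_iff₀ (by positivity), mul_one]
  exact h

/-! ### Total influence of halfspaces -/

theorem sum_toReal_mul_toReal (i j : Fin n) :
    ∑ z : Cube n, toReal (z i) * toReal (z j) = if i = j then 2 ^ n else 0 := by
  split_ifs with h
  · subst h
    simp [toReal_mul_self, Fintype.card_units_int]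
  · have key := Equiv.sum_comp (Equiv.mulRight (Pi.mulSingle i (-1) : Cube n))
      (fun z : Cube n => toReal (z i) * toReal (z j))
    simp only [Equiv.coe_mulRight, Pi.mul_apply, toReal_mul, Pi.mulSingle_eq_same,
      Pi.mulSingle_eq_of_ne (Ne.symm h), toReal_one, toReal_neg_one] at key
    have h2 : ∑ z : Cube n, toReal (z i) * -1 * (toReal (z j) * 1) =
        -∑ z : Cube n, toReal (z i) * toReal (z j) := by
      rw [← Finset.sum_neg_distrib]
      exact Finset.sum_congr rfl fun z _ => by ring
    linarith

theorem sum_sq_signed_sum (s : Fin n → ℤˣ) :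
    ∑ z : Cube n, (∑ i, toReal (s i) * toReal (z i)) ^ 2 = n * 2 ^ n := by
  have h : ∀ z : Cube n, (∑ i, toReal (s i) * toReal (z i)) ^ 2 =
      ∑ i, ∑ j, toReal (s i) * toReal (s j) * (toReal (z i) * toReal (z j)) := fun z => by
    rw [sq, Finset.sum_mul_sum]
    exact Finset.sum_congr rfl fun x _ => Finset.sum_congr rfl fun y _ => by ring
  simp_rw [h]
  rw [Finset.sum_comm]
  simp_rw [Finset.sum_comm (s := (Finset.univ : Finset (Cube n))), ← Finset.mul_sum,
    sum_toReal_mul_toReal]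
  simp [toReal_mul_self]

/-- Take `s i` to be the sign of `w i`. If flipping `z i` changes the value of `h`, then `w i * z i`
is nonzero and has the sign `h z`, so `s i * z i = h z`; otherwise both sides vanish. -/
theorem IsHalfspace.exists_orientation {h : Cube n → ℤˣ} (hh : IsHalfspace h) :
    ∃ s : Fin n → ℤˣ, ∀ i z,
      1 - toReal (h z) * toReal (h (z * Pi.mulSingle i (-1))) ≤
        toReal (s i) * toReal (z i) *
          (toReal (h z) - toReal (h (z * Pi.mulSingle i (-1)))) := by
  obtain ⟨w, hw⟩ := hh
  refine ⟨fun i => if 0 ≤ w i then 1 else -1, fun i z => ?_⟩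
  have hflip : ∑ j, w j * toReal ((z * Pi.mulSingle i (-1) : Cube n) j) =
      ∑ j, w j * toReal (z j) - 2 * (w i * toReal (z i)) := by
    rw [← Finset.add_sum_erase _ _ (Finset.mem_univ i),
      ← Finset.add_sum_erase _ (fun j => w j * toReal (z j)) (Finset.mem_univ i)]
    have : ∑ j ∈ Finset.univ.erase i, w j * toReal ((z * Pi.mulSingle i (-1) : Cube n) j) =
        ∑ j ∈ Finset.univ.erase i, w j * toReal (z j) :=
      Finset.sum_congr rfl fun j hj => by
        rw [Pi.mul_apply, Pi.mulSingle_eq_of_ne (Finset.ne_of_mem_erase hj), mul_one]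
    rw [this, Pi.mul_apply, Pi.mulSingle_eq_same, toReal_mul, toReal_neg_one]
    ring
  have h1 := hw z
  have h2 := hw (z * Pi.mulSingle i (-1))
  rw [hflip] at h2
  rcases Int.units_eq_one_or (h z) with ha | ha <;>
    rcases Int.units_eq_one_or (h (z * Pi.mulSingle i (-1))) with hb | hb <;>
    rw [ha] at h1 ⊢ <;> rw [hb] at h2 ⊢ <;>
    simp only [toReal_one, toReal_neg_one, true_iff, false_iff, not_le,
      show ((-1 : ℤˣ) = 1) = False by decide] at h1 h2 ⊢ <;>
    split_ifs with hwi <;> rcases toReal_eq_or (z i) with hz | hz <;> rw [hz] at h2 ⊢ <;>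
    simp only [toReal_one, toReal_neg_one] <;> linarith

/-- The total influence of a halfspace in `m` variables is at most `√m`. -/
theorem IsHalfspace.total_influence_le {h : Cube n → ℤˣ} (hh : IsHalfspace h) :
    ∑ i, ∑ z, (1 - toReal (h z) * toReal (h (z * Pi.mulSingle i (-1)))) / 2 ≤
      Real.sqrt n * 2 ^ n := by
  obtain ⟨s, hs⟩ := hh.exists_orientation
  have h1 : ∀ i, ∑ z, (1 - toReal (h z) * toReal (h (z * Pi.mulSingle i (-1)))) / 2 ≤
      ∑ z, toReal (h z) * (toReal (s i) * toReal (z i)) := fun i => by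
    -- Flipping coordinate `i` is a bijection of the cube that negates `z i`, so the two halves of
    -- the orientation bound have equal sums.
    have e := Equiv.sum_comp (Equiv.mulRight (Pi.mulSingle i (-1) : Cube n))
      (fun z : Cube n => toReal (h z) * (toReal (s i) * toReal (z i)))
    simp only [Equiv.coe_mulRight, Pi.mul_apply, toReal_mul, Pi.mulSingle_eq_same,
      toReal_neg_one] at e
    have e2 := Finset.sum_le_sum fun z (_ : z ∈ Finset.univ) => hs i z
    have e3 : ∑ z : Cube n, toReal (s i) * toReal (z i) *
          (toReal (h z) - toReal (h (z * Pi.mulSingle i (-1)))) =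
        ∑ z, toReal (h z) * (toReal (s i) * toReal (z i)) +
        ∑ z : Cube n, toReal (h (z * Pi.mulSingle i (-1))) * (toReal (s i) * (toReal (z i) * -1)) := by
      rw [← Finset.sum_add_distrib]
      exact Finset.sum_congr rfl fun z _ => by ring
    rw [← Finset.sum_div]
    linarith
  refine (Finset.sum_le_sum fun i _ => h1 i).trans ?_
  rw [Finset.sum_comm]
  simp_rw [← Finset.mul_sum]
  rcases Nat.eq_zero_or_pos n with rfl | hn
  · simp
  have hr : 0 < Real.sqrt n := Real.sqrt_pos.2 (by exact_mod_cast hn)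
  have hr2 : Real.sqrt n * Real.sqrt n = n := Real.mul_self_sqrt (Nat.cast_nonneg n)
  -- AM-GM in the form `|T| ≤ (T² + n) / (2√n)`, which replaces Cauchy–Schwarz; the mean of `T²` is
  -- `n`.
  have h2 : ∀ z : Cube n, toReal (h z) * ∑ i, toReal (s i) * toReal (z i) ≤
      ((∑ i, toReal (s i) * toReal (z i)) ^ 2 + n) / (2 * Real.sqrt n) := fun z => by
    rw [le_div_iff₀ (by positivity)]
    rcases toReal_eq_or (h z) with hz | hz <;> rw [hz]
    · nlinarith [sq_nonneg ((∑ i, toReal (s i) * toReal (z i)) - Real.sqrt n)]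
    · nlinarith [sq_nonneg ((∑ i, toReal (s i) * toReal (z i)) + Real.sqrt n)]
  refine (Finset.sum_le_sum fun z _ => h2 z).trans (le_of_eq ?_)
  rw [← Finset.sum_div, Finset.sum_add_distrib, sum_sq_signed_sum]
  simp only [Finset.sum_const, Finset.card_univ, card_cube, nsmul_eq_mul, Nat.cast_pow,
    Nat.cast_ofNat]
  rw [div_eq_iff (by positivity)]
  linear_combination (-2 * 2 ^ n) * hr2

/-! ### Fourier tails of halfspaces -/

variable {m : ℕ}

/-- The sign vector that flips exactly the coordinates in the block `i` of the partition `π`. -/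
def flipBlock (π : Fin n → Fin m) (i : Fin m) : Cube n :=
  fun j => if π j = i then -1 else 1

/-- The weight of a block sign is the sum of `w j * x j` over the block. -/
theorem IsHalfspace.comp_blocks {h : Cube n → ℤˣ} (hh : IsHalfspace h) (π : Fin n → Fin m)
    (x : Cube n) : IsHalfspace fun z : Cube m => h (x * z ∘ π) := by
  obtain ⟨w, hw⟩ := hh
  refine ⟨fun i => ∑ j with π j = i, w j * toReal (x j), fun z => ?_⟩
  rw [hw]
  have : ∑ j, w j * toReal ((x * z ∘ π) j) =
      ∑ i, (∑ j with π j = i, w j * toReal (x j)) * toReal (z i) := by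
    rw [← Finset.sum_fiberwise _ π]
    refine Finset.sum_congr rfl fun i _ => ?_
    rw [Finset.sum_mul]
    refine Finset.sum_congr rfl fun j hj => ?_
    rw [← (Finset.mem_filter.1 hj).2, Pi.mul_apply, toReal_mul, Function.comp_apply, mul_assoc]
  rw [this]

theorem IsHalfspace.block_influence_le {h : Cube n → ℤˣ} (hh : IsHalfspace h)
    (π : Fin n → Fin m) :
    ∑ i, ∑ x, (1 - toReal (h x) * toReal (h (x * flipBlock π i))) / 2 ≤
      Real.sqrt m * 2 ^ n := by
  have key := Finset.sum_le_sum fun x (_ : x ∈ Finset.univ) =>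
    (hh.comp_blocks π x).total_influence_le
  have hcomp : ∀ (x : Cube n) (z : Cube m) (i : Fin m),
      x * (z * Pi.mulSingle i (-1)) ∘ π = (x * z ∘ π) * flipBlock π i := fun x z i => by
    funext j
    by_cases hj : π j = i <;> simp [flipBlock, hj]
  simp_rw [hcomp] at key
  rw [Finset.sum_comm] at key
  -- For fixed `z`, multiplication by `z ∘ π` permutes the cube, so the sum over `x` does not depend
  -- on `z` and the average over `z` disappears.
  have hz : ∀ i, ∑ x : Cube n, ∑ z : Cube m,
        (1 - toReal (h (x * z ∘ π)) * toReal (h (x * z ∘ π * flipBlock π i))) / 2 =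
      2 ^ m * ∑ x, (1 - toReal (h x) * toReal (h (x * flipBlock π i))) / 2 := fun i => by
    rw [Finset.sum_comm]
    have : ∀ z : Cube m, ∑ x : Cube n,
        (1 - toReal (h (x * z ∘ π)) * toReal (h (x * z ∘ π * flipBlock π i))) / 2 =
        ∑ x, (1 - toReal (h x) * toReal (h (x * flipBlock π i))) / 2 := fun z =>
      Equiv.sum_comp (Equiv.mulRight (z ∘ π : Cube n))
        (fun x => (1 - toReal (h x) * toReal (h (x * flipBlock π i))) / 2)
    simp_rw [this]
    simp [Fintype.card_units_int]
  simp_rw [hz, ← Finset.mul_sum] at key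
  simp only [Finset.sum_const, Finset.card_univ, card_cube, nsmul_eq_mul, Nat.cast_pow,
    Nat.cast_ofNat] at key
  have hp : (0 : ℝ) < 2 ^ m := by positivity
  refine le_of_mul_le_mul_left ?_ hp
  linarith

theorem mean_mul_translate (h : Cube n → ℤˣ) (u : Cube n) :
    (1 / 2 ^ n) * ∑ x, toReal (h x) * toReal (h (x * u)) =
      ∑ S, character S u * fourier (fun x => toReal (h x)) S ^ 2 := by
  rw [← parseval (fun x => toReal (h x)) (fun x => toReal (h (x * u)))]
  refine Finset.sum_congr rfl fun S _ => ?_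
  rw [fourier_translate (fun x => toReal (h x))]
  ring

theorem sum_fourier_sq (h : Cube n → ℤˣ) : ∑ S, fourier (fun x => toReal (h x)) S ^ 2 = 1 := by
  simp_rw [sq]
  rw [parseval]
  simp [toReal_mul_self, Fintype.card_units_int]

/-- The block influence bound in Fourier form: translation by a flip multiplies each coefficient by
a character value, and the squared coefficients of `h` sum to `1`. -/
theorem IsHalfspace.block_fourier_le {h : Cube n → ℤˣ} (hh : IsHalfspace h)
    (π : Fin n → Fin m) :
    ∑ i, ∑ S, (1 - character S (flipBlock π i)) * fourier (fun x => toReal (h x)) S ^ 2 ≤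
      2 * Real.sqrt m := by
  have key := hh.block_influence_le π
  have e : ∀ i, ∑ x, (1 - toReal (h x) * toReal (h (x * flipBlock π i))) / 2 =
      2 ^ n / 2 * ∑ S, (1 - character S (flipBlock π i)) *
        fourier (fun x => toReal (h x)) S ^ 2 := fun i => by
    simp_rw [sub_mul, one_mul, Finset.sum_sub_distrib]
    rw [sum_fourier_sq, ← mean_mul_translate, ← Finset.sum_div, Finset.sum_sub_distrib]
    simp only [Finset.sum_const, Finset.card_univ, card_cube, nsmul_eq_mul, Nat.cast_pow,
      Nat.cast_ofNat]
    field_simp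
  simp_rw [e, ← Finset.mul_sum] at key
  have hp : (0 : ℝ) < 2 ^ n / 2 := by positivity
  refine le_of_mul_le_mul_left ?_ hp
  linarith

/-- Under a uniform `π` the coordinates choose their blocks independently, and each one in `S`
contributes a sign of mean `1 - 2/m`. -/
theorem sum_character_flipBlock (hm : 0 < m) (i : Fin m) (S : Finset (Fin n)) :
    ∑ π : Fin n → Fin m, character S (flipBlock π i) = m ^ n * (1 - 2 / m) ^ S.card := by
  have hm' : (m : ℝ) ≠ 0 := by positivity
  have h1 : ∀ π : Fin n → Fin m, character S (flipBlock π i) =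
      ∏ j, if j ∈ S then (if π j = i then (-1 : ℝ) else 1) else 1 := fun π => by
    rw [Finset.prod_ite_mem, Finset.univ_inter]
    refine Finset.prod_congr rfl fun j _ => ?_
    unfold flipBlock
    split_ifs <;> simp
  simp_rw [h1]
  rw [← Fintype.piFinset_univ, ← Finset.prod_univ_sum (fun _ => Finset.univ)
    (fun j v => if j ∈ S then (if v = i then (-1 : ℝ) else 1) else 1)]
  have h2 : ∀ j, (∑ v : Fin m, if j ∈ S then (if v = i then (-1 : ℝ) else 1) else 1) =
      m * if j ∈ S then (1 - 2 / m : ℝ) else 1 := fun j => by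
    split_ifs
    · have : ∀ v : Fin m, (if v = i then (-1 : ℝ) else 1) = 1 - if v = i then 2 else 0 := fun v => by
        split_ifs <;> norm_num
      simp_rw [this, Finset.sum_sub_distrib]
      simp
      field_simp
    · simp
  simp_rw [h2, Finset.prod_mul_distrib, Finset.prod_ite_mem, Finset.univ_inter]
  simp

/-- Halfspaces have Fourier weight `O(1 / √a)` at the levels `≥ a`. -/
theorem IsHalfspace.fourier_tail_le {h : Cube n → ℤˣ} (hh : IsHalfspace h) {a : ℕ} (ha : 0 < a) :
    ∑ S with ¬ S.card < a, fourier (fun x => toReal (h x)) S ^ 2 ≤ 3 / Real.sqrt a := by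
  have ha' : (0 : ℝ) < a := by exact_mod_cast ha
  -- With `2 * a` blocks the decay factor is `1 - 1/a`, whose powers from exponent `a` on are at
  -- most `exp (-1) ≤ 1/2`.
  have key := Finset.sum_le_sum fun π (_ : π ∈ (Finset.univ : Finset (Fin n → Fin (2 * a)))) =>
    hh.block_fourier_le π
  rw [Finset.sum_comm] at key
  simp_rw [Finset.sum_comm (s := (Finset.univ : Finset (Fin n → Fin (2 * a)))), ← Finset.sum_mul,
    Finset.sum_sub_distrib, sum_character_flipBlock (by omega : 0 < 2 * a)] at key
  simp only [Finset.sum_const, Finset.card_univ, nsmul_eq_mul, Fintype.card_fun, Fintype.card_fin,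
    Nat.cast_pow, Nat.cast_mul, Nat.cast_ofNat, mul_one] at key
  have hs : Real.sqrt (2 * a) ≤ 1.5 * Real.sqrt a := by
    rw [Real.sqrt_mul (by norm_num)]
    gcongr
    rw [Real.sqrt_le_left (by norm_num)]
    norm_num
  have hra : 0 < Real.sqrt a := Real.sqrt_pos.2 ha'
  have hra2 : Real.sqrt a * Real.sqrt a = a := Real.mul_self_sqrt ha'.le
  have hbase : ∀ s, ¬ s < a → (1 - 2 / (2 * a) : ℝ) ^ s ≤ 1 / 2 := fun s hs => by
    have e1 : (1 - 2 / (2 * a) : ℝ) = 1 - 1 / a := by field_simp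
    have e0 : (0 : ℝ) ≤ 1 - 1 / a := by
      rw [sub_nonneg, div_le_one ha']; exact_mod_cast ha
    have e2 : (1 - 1 / a : ℝ) ≤ Real.exp (-(1 / a)) := by
      have := Real.add_one_le_exp (-(1 / a : ℝ)); linarith
    rw [e1]
    calc (1 - 1 / a : ℝ) ^ s ≤ (1 - 1 / a : ℝ) ^ a :=
          pow_le_pow_of_le_one e0 (by simp) (not_lt.1 hs)
      _ ≤ Real.exp (-(1 / a)) ^ a := by gcongr
      _ = Real.exp (-1) := by rw [← Real.exp_nat_mul]; congr 1; field_simp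
      _ ≤ 1 / 2 := by
        rw [Real.exp_neg, one_div]
        gcongr
        have := Real.add_one_le_exp (1 : ℝ); linarith
  have hle1 : ∀ s : ℕ, (1 - 2 / (2 * a) : ℝ) ^ s ≤ 1 := fun s => by
    have e1 : (1 - 2 / (2 * a) : ℝ) = 1 - 1 / a := by field_simp
    rw [e1]
    refine pow_le_one₀ ?_ (by simp)
    rw [sub_nonneg, div_le_one ha']; exact_mod_cast ha
  have hP : (0 : ℝ) < (2 * a) ^ n := by positivity
  have hlow : (2 * a) ^ n * (1 / 2) * ∑ S with ¬ S.card < a, fourier (fun x => toReal (h x)) S ^ 2 ≤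
      ∑ S, ((2 * (a : ℝ)) ^ n - (2 * a) ^ n * (1 - 2 / (2 * a)) ^ S.card) *
        fourier (fun x => toReal (h x)) S ^ 2 := by
    rw [Finset.mul_sum, Finset.sum_filter]
    refine Finset.sum_le_sum fun S _ => ?_
    by_cases hS : S.card < a
    · rw [if_neg (not_not.2 hS)]
      refine mul_nonneg ?_ (sq_nonneg _)
      nlinarith [hle1 S.card]
    · rw [if_pos hS]
      refine mul_le_mul_of_nonneg_right ?_ (sq_nonneg _)
      nlinarith [hbase _ hS]
  rw [le_div_iff₀ hra]
  have h3 : (2 * a : ℝ) * ((2 * a) ^ n * (1 / 2) *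
      ∑ S with ¬ S.card < a, fourier (fun x => toReal (h x)) S ^ 2) ≤
      (2 * a) ^ n * (2 * (1.5 * Real.sqrt a)) :=
    (mul_le_mul_of_nonneg_left hlow (by positivity)).trans (key.trans
      (by rw [mul_assoc]; gcongr))
  set W := ∑ S with ¬ S.card < a, fourier (fun x => toReal (h x)) S ^ 2
  have h4 : (a : ℝ) * W ≤ 3 * Real.sqrt a := by
    refine le_of_mul_le_mul_left ?_ hP
    linarith
  refine le_of_mul_le_mul_right ?_ hra
  rw [mul_assoc, hra2]
  linarith

end ExpectedDiameter

namespace ExpectedDiameter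

/-! ### Concentration of empirical means -/

/-- Chernoff's method with `exp u ≤ 1 + u + u²` for `|u| ≤ 1`. The exponent per sample is `-tδ +
4t²`, which is smallest at `t = δ/8` with value `-δ²/16`. -/
theorem card_sum_gt_le {α : Type*} [Fintype α] (k : ℕ) (f : α → ℝ)
    (hf : ∑ x, f x = 0) (hb : ∀ x, |f x| ≤ 2) {δ : ℝ} (h0 : 0 ≤ δ) (h1 : δ ≤ 1) :
    (({X : Fin k → α | k * δ < ∑ i, f (X i)} : Set (Fin k → α)).ncard : ℝ) ≤
      Real.exp (-(k * δ ^ 2 / 16)) * Fintype.card α ^ k := by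
  classical
  set t : ℝ := δ / 8 with ht
  have hmgf : ∑ x, Real.exp (t * f x) ≤ Fintype.card α * Real.exp (4 * t ^ 2) := by
    have hx : ∀ x, Real.exp (t * f x) ≤ 1 + t * f x + 4 * t ^ 2 := fun x => by
      have hsq : f x ^ 2 ≤ 2 ^ 2 := sq_le_sq' (abs_le.1 (hb x)).1 (abs_le.1 (hb x)).2
      have hle : |t * f x| ≤ 1 := by
        rw [abs_mul, abs_of_nonneg (by positivity)]
        nlinarith [hb x, abs_nonneg (f x)]
      have := (abs_le.1 (Real.abs_exp_sub_one_sub_id_le hle)).2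
      nlinarith [sq_nonneg t]
    refine (Finset.sum_le_sum fun x _ => hx x).trans ?_
    rw [Finset.sum_add_distrib, Finset.sum_add_distrib, ← Finset.mul_sum, hf]
    simp only [Finset.sum_const, Finset.card_univ, nsmul_eq_mul]
    have := Real.add_one_le_exp (4 * t ^ 2)
    have hc : (0 : ℝ) ≤ Fintype.card α := Nat.cast_nonneg _
    nlinarith
  rw [Set.ncard_eq_toFinset_card']
  have hcard : ((Set.toFinset {X : Fin k → α | k * δ < ∑ i, f (X i)}).card : ℝ) ≤
      ∑ X : Fin k → α, Real.exp (-(t * (k * δ))) * ∏ i, Real.exp (t * f (X i)) := by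
    rw [Finset.card_eq_sum_ones, Nat.cast_sum]
    refine (Finset.sum_le_sum fun X hX => ?_).trans
      (Finset.sum_le_sum_of_subset_of_nonneg (Finset.subset_univ _) fun X _ _ => by positivity)
    rw [← Real.exp_sum, ← Real.exp_add, Nat.cast_one, Real.one_le_exp_iff, ← Finset.mul_sum]
    have : k * δ < ∑ i, f (X i) := by simpa using hX
    have ht0 : 0 ≤ t := by positivity
    nlinarith
  refine hcard.trans ?_
  rw [← Finset.mul_sum, ← Fintype.sum_pow fun x => Real.exp (t * f x)]
  calc _ ≤ Real.exp (-(t * (k * δ))) * (Fintype.card α * Real.exp (4 * t ^ 2)) ^ k := by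
        gcongr
    _ = _ := by
        rw [mul_pow, ← Real.exp_nat_mul, mul_left_comm, ← Real.exp_add, mul_comm]
        congr 2
        rw [ht]; ring

/-- The empirical Fourier coefficients of every halfspace are accurate on the sample `X`. -/
def Representative {n k : ℕ} (δ : ℝ) (X : Fin k → Cube n) : Prop :=
  ∀ h, IsHalfspace h → ∀ S, |empirical (X, fun i => h (X i)) S - fourier (fun x => toReal (h x)) S| ≤ δ

variable {n k : ℕ}

theorem ncard_deviation_le (hk : 0 < k) (h : Cube n → ℤˣ) (S : Finset (Fin n)) {δ : ℝ} (h0 : 0 ≤ δ)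
    (h1 : δ ≤ 1) :
    (({X : Fin k → Cube n | ¬ |empirical (X, fun i => h (X i)) S -
        fourier (fun x => toReal (h x)) S| ≤ δ} : Set (Fin k → Cube n)).ncard : ℝ) ≤
      2 * (Real.exp (-(k * δ ^ 2 / 16)) * (2 ^ n) ^ k) := by
  have hk' : (0 : ℝ) < k := by exact_mod_cast hk
  set μ := fourier (fun x => toReal (h x)) S with hμ
  set f : Cube n → ℝ := fun x => character S x * toReal (h x) - μ with hf
  have hsum : ∑ x, f x = 0 := by
    rw [hf, Finset.sum_sub_distrib, hμ, fourier]
    simp only [Finset.sum_const, Finset.card_univ, card_cube, nsmul_eq_mul, Nat.cast_pow,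
      Nat.cast_ofNat]
    rw [← mul_assoc, mul_one_div_cancel (by positivity), one_mul, sub_eq_zero]
    exact Finset.sum_congr rfl fun x _ => mul_comm _ _
  have hμ1 : |μ| ≤ 1 := abs_fourier_le _ (fun x => (abs_toReal _).le) S
  have hb : ∀ x, |f x| ≤ 2 := fun x => by
    refine (abs_sub _ _).trans ?_
    rw [abs_mul, abs_character, abs_toReal]
    linarith
  have hdev : ∀ X : Fin k → Cube n, empirical (X, fun i => h (X i)) S - μ =
      (∑ i, f (X i)) / k := fun X => by
    rw [hf, Finset.sum_sub_distrib, empirical]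
    simp only [Finset.sum_const, Finset.card_univ, Fintype.card_fin, nsmul_eq_mul]
    field_simp
  have hsub : {X : Fin k → Cube n | ¬ |empirical (X, fun i => h (X i)) S - μ| ≤ δ} ⊆
      {X | k * δ < ∑ i, f (X i)} ∪ {X | k * δ < ∑ i, (-f) (X i)} := fun X hX => by
    rw [Set.mem_ofPred_eq, hdev, not_le, lt_abs] at hX
    rcases hX with hX | hX
    · left
      rw [lt_div_iff₀ hk'] at hX
      rw [Set.mem_ofPred_eq]; linarith
    · right
      rw [← neg_div, lt_div_iff₀ hk'] at hX
      simp only [Set.mem_ofPred_eq, Pi.neg_apply, Finset.sum_neg_distrib]; linarith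
  have c1 := card_sum_gt_le k f hsum hb h0 h1
  have c2 := card_sum_gt_le k (-f) (by simp [hsum]) (fun x => by simpa using hb x) h0 h1
  rw [card_cube, Nat.cast_pow, Nat.cast_ofNat] at c1 c2
  have h3 : ({X : Fin k → Cube n | ¬ |empirical (X, fun i => h (X i)) S - μ| ≤ δ}.ncard : ℝ) ≤
      ({X : Fin k → Cube n | k * δ < ∑ i, f (X i)}.ncard : ℝ) +
        ({X : Fin k → Cube n | k * δ < ∑ i, (-f) (X i)}.ncard : ℝ) := by
    exact_mod_cast (Set.ncard_le_ncard hsub (Set.toFinite _)).trans (Set.ncard_union_le _ _)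
  linarith

/-! ### The number of halfspaces -/

/-- A halfspace is determined among all Boolean functions by its Chow parameters. -/
theorem IsHalfspace.eq_of_chow {h g : Cube n → ℤˣ} (hh : IsHalfspace h)
    (h0 : ∑ x, ((h x : ℤˣ) : ℤ) = ∑ x, ((g x : ℤˣ) : ℤ))
    (h1 : ∀ j, ∑ x : Cube n, ((h x * x j : ℤˣ) : ℤ) = ∑ x, ((g x * x j : ℤˣ) : ℤ)) : h = g := by
  obtain ⟨w, hw⟩ := hh
  -- Equal degree-one parameters make this sum vanish, while each term is nonnegative because `h` is
  -- the sign of `w · x`. So `h = g` off the hyperplane `w · x = 0`.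
  have e1 : ∑ x, (toReal (h x) - toReal (g x)) * ∑ j, w j * toReal (x j) = 0 := by
    simp_rw [Finset.mul_sum]
    rw [Finset.sum_comm]
    refine Finset.sum_eq_zero fun j _ => ?_
    have e : ∑ x : Cube n, toReal (h x * x j) = ∑ x, toReal (g x * x j) := by
      have := congrArg (Int.cast : ℤ → ℝ) (h1 j)
      simpa only [toReal, Int.cast_sum] using this
    have : ∑ x : Cube n, (toReal (h x) - toReal (g x)) * (w j * toReal (x j)) =
        w j * (∑ x : Cube n, toReal (h x * x j) - ∑ x, toReal (g x * x j)) := by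
      rw [← Finset.sum_sub_distrib, Finset.mul_sum]
      exact Finset.sum_congr rfl fun x _ => by rw [toReal_mul, toReal_mul]; ring
    rw [this, e, sub_self, mul_zero]
  have p1 : ∀ x, 0 ≤ (toReal (h x) - toReal (g x)) * ∑ j, w j * toReal (x j) := fun x => by
    have hx := hw x
    rcases Int.units_eq_one_or (h x) with ha | ha
    · have := hx.1 ha
      rw [ha]
      refine mul_nonneg ?_ this
      rcases toReal_eq_or (g x) with hg | hg <;> rw [hg] <;> simp
    · have : ¬ 0 ≤ ∑ j, w j * toReal (x j) := fun hc => by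
        rw [hx.2 hc] at ha; exact absurd ha (by decide)
      rw [ha]
      refine mul_nonneg_of_nonpos_of_nonpos ?_ (not_le.1 this).le
      rcases toReal_eq_or (g x) with hg | hg <;> rw [hg] <;> simp
  have z1 := (Finset.sum_eq_zero_iff_of_nonneg fun x _ => p1 x).1 e1
  -- On the hyperplane the convention `sign 0 = 1` gives `h x = 1 ≥ g x`; equality of the means then
  -- excludes any remaining difference.
  have p2 : ∀ x, 0 ≤ toReal (h x) - toReal (g x) := fun x => by
    rcases mul_eq_zero.1 (z1 x (Finset.mem_univ x)) with hz | hz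
    · exact hz.ge
    · rw [(hw x).2 hz.ge]
      rcases toReal_eq_or (g x) with hg | hg <;> rw [hg] <;> simp
  have e2 : ∑ x, (toReal (h x) - toReal (g x)) = 0 := by
    have := congrArg (Int.cast : ℤ → ℝ) h0
    rw [Finset.sum_sub_distrib, sub_eq_zero]
    simpa only [toReal, Int.cast_sum] using this
  have z2 := (Finset.sum_eq_zero_iff_of_nonneg fun x _ => p2 x).1 e2
  funext x
  have := sub_eq_zero.1 (z2 x (Finset.mem_univ x))
  rw [toReal, toReal, Int.cast_inj, Units.val_inj] at this
  exact this

theorem sum_units_mem_Icc (u : Cube n → ℤˣ) :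
    ∑ x, ((u x : ℤˣ) : ℤ) ∈ Finset.Icc (-2 ^ n : ℤ) (2 ^ n) := by
  rw [Finset.mem_Icc, ← abs_le]
  refine (Finset.abs_sum_le_sum_abs _ _).trans ?_
  have : ∀ v : ℤˣ, |(v : ℤ)| = 1 := fun v => by
    rcases Int.units_eq_one_or v with rfl | rfl <;> simp
  simp [this, Fintype.card_units_int]

/-- The `n + 1` Chow parameters are integers between `-2^n` and `2^n`, and they determine the
halfspace. -/
theorem ncard_halfspaces_le : {h : Cube n → ℤˣ | IsHalfspace h}.ncard ≤ 2 ^ (n + 2) ^ 2 := by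
  classical
  rw [Set.ncard_eq_toFinset_card']
  let T := (Finset.Icc (-2 ^ n : ℤ) (2 ^ n)) ×ˢ
    Fintype.piFinset fun _ : Fin n => Finset.Icc (-2 ^ n : ℤ) (2 ^ n)
  have hT : T.card = (2 ^ (n + 1) + 1) ^ (n + 1) := by
    have : (2 ^ n + 1 - -2 ^ n : ℤ).toNat = 2 ^ (n + 1) + 1 := by
      have : (2 ^ n + 1 - -2 ^ n : ℤ) = ((2 ^ (n + 1) + 1 : ℕ) : ℤ) := by push_cast; ring
      rw [this, Int.toNat_natCast]
    simp only [T, Finset.card_product, Fintype.card_piFinset, Int.card_Icc, Finset.prod_const,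
      Finset.card_univ, Fintype.card_fin, this]
    ring
  have hcard : (Set.toFinset {h : Cube n → ℤˣ | IsHalfspace h}).card ≤ T.card := by
    refine Finset.card_le_card_of_injOn
      (fun h => (∑ x, ((h x : ℤˣ) : ℤ), fun j => ∑ x : Cube n, ((h x * x j : ℤˣ) : ℤ))) ?_ ?_
    · intro h _
      simp only [T, Finset.coe_product, Set.mem_prod, Finset.mem_coe, Fintype.mem_piFinset]
      exact ⟨sum_units_mem_Icc h, fun j => sum_units_mem_Icc fun x => h x * x j⟩
    · intro h hh g _ he
      have hh' : IsHalfspace h := by simpa using hh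
      exact hh'.eq_of_chow (congrArg Prod.fst he) fun j => congrFun (congrArg Prod.snd he) j
  calc _ ≤ (2 ^ (n + 1) + 1) ^ (n + 1) := hcard.trans hT.le
    _ ≤ (2 ^ (n + 2)) ^ (n + 1) := by
      gcongr
      have := Nat.one_le_two_pow (n := n + 1)
      rw [pow_succ 2 (n + 1)]; omega
    _ ≤ 2 ^ (n + 2) ^ 2 := by
      rw [← pow_mul]
      exact Nat.pow_le_pow_right (by norm_num) (by nlinarith)

/-! ### Most samples are representative -/

/-- Union bound over all halfspaces and all `2^n` characters. -/
theorem ncard_not_representative_le (hk : 0 < k) {δ : ℝ} (h0 : 0 ≤ δ) (h1 : δ ≤ 1) :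
    ({X : Fin k → Cube n | ¬ Representative δ X}.ncard : ℝ) ≤
      2 ^ (n + 2) ^ 2 * (2 ^ n * (2 * (Real.exp (-(k * δ ^ 2 / 16)) * (2 ^ n) ^ k))) := by
  classical
  let B : (Cube n → ℤˣ) → Finset (Fin n) → Finset (Fin k → Cube n) := fun h S =>
    Set.toFinset {X | ¬ |empirical (X, fun i => h (X i)) S - fourier (fun x => toReal (h x)) S| ≤ δ}
  let H : Finset (Cube n → ℤˣ) := Set.toFinset {h | IsHalfspace h}
  have hH : (H.card : ℝ) ≤ 2 ^ (n + 2) ^ 2 := by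
    have := ncard_halfspaces_le (n := n)
    rw [Set.ncard_eq_toFinset_card'] at this
    exact_mod_cast this
  have hB : ∀ h S, ((B h S).card : ℝ) ≤ 2 * (Real.exp (-(k * δ ^ 2 / 16)) * (2 ^ n) ^ k) :=
    fun h S => by
      have := ncard_deviation_le hk h S h0 h1
      rwa [Set.ncard_eq_toFinset_card'] at this
  have hsub : Set.toFinset {X : Fin k → Cube n | ¬ Representative δ X} ⊆
      H.biUnion fun h => Finset.univ.biUnion fun S => B h S := fun X hX => by
    simp only [Set.mem_toFinset, Set.mem_ofPred_eq, Representative, not_forall] at hX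
    obtain ⟨h, hh, S, hS⟩ := hX
    simp only [Finset.mem_biUnion, Finset.mem_univ, true_and]
    exact ⟨h, by simpa [H] using hh, S, by simpa [B] using hS⟩
  rw [Set.ncard_eq_toFinset_card']
  have e := (Finset.card_le_card hsub).trans (Finset.card_biUnion_le.trans
    (Finset.sum_le_sum fun h _ => Finset.card_biUnion_le))
  refine (Nat.cast_le (α := ℝ).2 e).trans ?_
  push_cast
  calc ∑ h ∈ H, ∑ S, ((B h S).card : ℝ)
      ≤ ∑ h ∈ H, ∑ S : Finset (Fin n), 2 * (Real.exp (-(k * δ ^ 2 / 16)) * (2 ^ n) ^ k) := by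
        gcongr with h _ S _
        exact hB h S
    _ = H.card * (2 ^ n * (2 * (Real.exp (-(k * δ ^ 2 / 16)) * (2 ^ n) ^ k))) := by
        simp only [Finset.sum_const, Finset.card_univ, Fintype.card_finset, Fintype.card_fin,
          nsmul_eq_mul, Nat.cast_pow, Nat.cast_ofNat]
    _ ≤ _ := by gcongr

theorem isHalfspace_one : IsHalfspace (fun _ : Cube n => 1) := ⟨0, by simp⟩

/-- A consistently labelled dataset is a sample together with a halfspace, so each bad sample
carries at most `2^(n+2)²` bad labellings. The extra factor in `hG` pays for this, and each sample
has at least one consistent labelling. -/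
theorem ForMostDatasets.of_ncard_le {Q : Dataset n k → Prop} {G : (Fin k → Cube n) → Prop}
    (hQ : ∀ X y, G X → (consistent (X, y)).Nonempty → Q (X, y))
    (hG : ({X | ¬ G X}.ncard : ℝ) * 2 ^ (n + 2) ^ 2 ≤
      Real.exp (-(n : ℝ)) * (Set.univ : Set (Fin k → Cube n)).ncard) :
    ForMostDatasets n k Q := by
  have hbad : {X : Fin k → Cube n | ∃ y, (consistent (X, y)).Nonempty ∧ ¬ Q (X, y)} ⊆
      {X | ¬ G X} := by
    rintro X ⟨y, hy, hq⟩ hX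
    exact hq (hQ X y hX hy)
  constructor
  · have h1 : ({X : Fin k → Cube n | ∃ y, (consistent (X, y)).Nonempty ∧ ¬ Q (X, y)}.ncard : ℝ) ≤
        {X | ¬ G X}.ncard := by
      exact_mod_cast Set.ncard_le_ncard hbad (Set.toFinite _)
    refine (h1.trans ?_).trans hG
    exact le_mul_of_one_le_right (Nat.cast_nonneg _) (one_le_pow₀ (by norm_num))
  · have h1 : {D : Dataset n k | (consistent D).Nonempty ∧ ¬ Q D}.ncard ≤
        {X | ¬ G X}.ncard * 2 ^ (n + 2) ^ 2 := by
      have hsub : {D : Dataset n k | (consistent D).Nonempty ∧ ¬ Q D} ⊆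
          (fun p : (Fin k → Cube n) × (Cube n → ℤˣ) => (p.1, fun i => p.2 (p.1 i))) ''
            ({X | ¬ G X} ×ˢ {h | IsHalfspace h}) := by
        rintro ⟨X, y⟩ ⟨⟨h, hh, hy⟩, hq⟩
        refine ⟨(X, h), ⟨hbad ⟨y, ⟨h, hh, hy⟩, hq⟩, hh⟩, ?_⟩
        exact Prod.ext rfl (funext hy)
      refine (Set.ncard_le_ncard hsub (Set.toFinite _)).trans
        ((Set.ncard_image_le (Set.toFinite _)).trans ?_)
      rw [Set.ncard_prod]
      exact Nat.mul_le_mul_left _ ncard_halfspaces_le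
    have h2 : (Set.univ : Set (Fin k → Cube n)).ncard ≤
        {D : Dataset n k | (consistent D).Nonempty}.ncard :=
      Set.ncard_le_ncard_of_injOn (fun X => (X, fun _ => 1))
        (fun X _ => ⟨fun _ => 1, isHalfspace_one, fun _ => rfl⟩)
        (fun X _ Y _ h => congrArg Prod.fst h) (Set.toFinite _)
    calc ({D : Dataset n k | (consistent D).Nonempty ∧ ¬ Q D}.ncard : ℝ)
        ≤ {X | ¬ G X}.ncard * 2 ^ (n + 2) ^ 2 := by exact_mod_cast h1
      _ ≤ _ := hG
      _ ≤ _ := by gcongr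

theorem ForMostDatasets.of_representative {Q : Dataset n k → Prop} {δ : ℝ} (h0 : 0 ≤ δ) (h1 : δ ≤ 1)
    (hn : 2 ≤ n) (hk : 160 * (n : ℝ) ^ 2 ≤ k * δ ^ 2)
    (hQ : ∀ X y, Representative δ X → (consistent (X, y)).Nonempty → Q (X, y)) :
    ForMostDatasets n k Q := by
  have hn' : (2 : ℝ) ≤ n := by exact_mod_cast hn
  have hk0 : 0 < k := by
    rcases Nat.eq_zero_or_pos k with rfl | h
    · rw [Nat.cast_zero, zero_mul] at hk
      nlinarith
    · exact h
  refine .of_ncard_le hQ ?_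
  rw [Set.ncard_univ, Nat.card_eq_fintype_card]
  simp only [Fintype.card_fun, Fintype.card_fin, Fintype.card_units_int, Nat.cast_pow,
    Nat.cast_ofNat]
  calc _ ≤ 2 ^ (n + 2) ^ 2 * (2 ^ n * (2 * (Real.exp (-(k * δ ^ 2 / 16)) * (2 ^ n) ^ k))) *
        2 ^ (n + 2) ^ 2 := by
        gcongr; exact ncard_not_representative_le hk0 h0 h1
    _ = (2 : ℝ) ^ (2 * (n + 2) ^ 2 + n + 1) * Real.exp (-(k * δ ^ 2 / 16)) * (2 ^ n) ^ k := by
        rw [pow_add, pow_add, two_mul ((n + 2) ^ 2), pow_add]; ring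
    -- After `2 ≤ e`, it remains that `2(n+2)² + 2n + 1 ≤ 10n² ≤ kδ²/16`, which holds from `n = 2`
    -- on.
    _ ≤ Real.exp (2 * (n + 2) ^ 2 + n + 1 : ℕ) * Real.exp (-(k * δ ^ 2 / 16)) * (2 ^ n) ^ k := by
        gcongr
        rw [← Real.exp_one_pow]
        gcongr
        have := Real.add_one_le_exp (1 : ℝ); linarith
    _ ≤ Real.exp (-n) * (2 ^ n) ^ k := by
        rw [← Real.exp_add]
        gcongr
        push_cast
        nlinarith

end ExpectedDiameter

namespace ExpectedDiameter

/-! ### Verification of programs -/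

/-- Started in state `s`, the program `P` halts within `T` steps in a state that satisfies `Q`. -/
def Halts (P : Prog) (s : RamState) (T : ℕ) (Q : RamState → Prop) : Prop :=
  ∃ t s', Exec P s t s' ∧ t ≤ T ∧ Q s'

theorem Halts.mono {P : Prog} {s : RamState} {T T' : ℕ} {Q Q' : RamState → Prop}
    (h : Halts P s T Q) (hT : T ≤ T') (hQ : ∀ s', Q s' → Q' s') : Halts P s T' Q' := by
  obtain ⟨t, s', he, ht, hs⟩ := h
  exact ⟨t, s', he, ht.trans hT, hQ s' hs⟩

theorem Halts.seq {P P' : Prog} {s : RamState} {T T' : ℕ} {Q Q' : RamState → Prop}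
    (h : Halts P s T Q) (h' : ∀ s', Q s' → Halts P' s' T' Q') :
    Halts (.seq P P') s (T + T') Q' := by
  obtain ⟨t, s', he, ht, hs⟩ := h
  obtain ⟨t', s'', he', ht', hs'⟩ := h' s' hs
  exact ⟨t + t', s'', .seq he he', by omega, hs'⟩

/-- A loop that counts the register `r` down from `K` to `0`. -/
theorem Halts.whilePos {I : ℕ → RamState → Prop} {r : ℕ} {P : Prog} {T K : ℕ}
    (hI : ∀ q s, q ≤ K → I q s → s.reg r = (K : ℤ) - q)
    (hP : ∀ q s, q < K → I q s → Halts P s T (I (q + 1))) {s : RamState} (hs : I 0 s) :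
    Halts (.whilePos r P) s (K * (T + 1) + 1) (I K) := by
  have key : ∀ d q s, q + d = K → I q s → Halts (.whilePos r P) s (d * (T + 1) + 1) (I K) := by
    intro d
    induction d with
    | zero =>
      intro q s hq hs
      have : q = K := by omega
      subst this
      exact ⟨1, s, .while_false (by rw [hI _ _ le_rfl hs]; omega), by omega, hs⟩
    | succ d ih =>
      intro q s hq hs
      obtain ⟨t, s', he, ht, hs'⟩ := hP q s (by omega) hs
      obtain ⟨t', s'', he', ht', hs''⟩ := ih (q + 1) s' (by omega) hs'
      refine ⟨t + t' + 1, s'', .while_true (by rw [hI _ _ (by omega) hs]; omega) he he', ?_, hs''⟩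
      rw [add_mul]; omega
  exact key K 0 s (by omega) hs

/-- The final state of a program without loops. -/
def Prog.run : Prog → RamState → RamState
  | .const r c, s => ⟨Function.update s.reg r c, s.mem⟩
  | .add r i j, s => ⟨Function.update s.reg r (s.reg i + s.reg j), s.mem⟩
  | .sub r i j, s => ⟨Function.update s.reg r (s.reg i - s.reg j), s.mem⟩
  | .load r i, s => ⟨Function.update s.reg r (s.mem (s.reg i).toNat), s.mem⟩
  | .store r i, s => ⟨s.reg, Function.update s.mem (s.reg r).toNat (s.reg i)⟩
  | .seq P Q, s => Q.run (P.run s)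
  | .ifPos r P Q, s => if 0 < s.reg r then P.run s else Q.run s
  | .whilePos _ _, s => s

/-- A bound for the running time of a program without loops. -/
def Prog.size : Prog → ℕ
  | .seq P Q => P.size + Q.size
  | .ifPos _ P Q => P.size + Q.size + 1
  | .whilePos _ P => P.size
  | _ => 1

/-- The program contains no loop. -/
def Prog.LoopFree : Prog → Prop
  | .seq P Q => P.LoopFree ∧ Q.LoopFree
  | .ifPos _ P Q => P.LoopFree ∧ Q.LoopFree
  | .whilePos _ _ => False
  | _ => True

/-- Reduces the verification of loop-free code to evaluating `Prog.run`; only genuine loops need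
invariants. -/
theorem Prog.LoopFree.halts {P : Prog} (hP : P.LoopFree) {s : RamState} {Q : RamState → Prop}
    (hQ : Q (P.run s)) : Halts P s P.size Q := by
  suffices h : ∃ t, Exec P s t (P.run s) ∧ t ≤ P.size by
    obtain ⟨t, he, ht⟩ := h
    exact ⟨t, _, he, ht, hQ⟩
  clear hQ
  induction P generalizing s with
  | const r c => exact ⟨1, .const r c s, le_rfl⟩
  | add r i j => exact ⟨1, .add r i j s, le_rfl⟩
  | sub r i j => exact ⟨1, .sub r i j s, le_rfl⟩
  | load r i => exact ⟨1, .load r i s, le_rfl⟩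
  | store r i => exact ⟨1, .store r i s, le_rfl⟩
  | seq P P' ih ih' =>
    obtain ⟨t, he, ht⟩ := ih hP.1 (s := s)
    obtain ⟨t', he', ht'⟩ := ih' hP.2 (s := P.run s)
    exact ⟨t + t', .seq he he', Nat.add_le_add ht ht'⟩
  | ifPos r P P' ih ih' =>
    by_cases h : 0 < s.reg r
    · obtain ⟨t, he, ht⟩ := ih hP.1 (s := s)
      exact ⟨t + 1, by simpa [Prog.run, h] using Exec.ifPos_true h he, by simp [Prog.size]; omega⟩
    · obtain ⟨t, he, ht⟩ := ih' hP.2 (s := s)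
      refine ⟨t + 1, ?_, by simp [Prog.size]; omega⟩
      rw [Prog.run, if_neg h]
      exact .ifPos_false h he
  | whilePos r P => exact hP.elim

/-! ### Elementary symmetric polynomials -/

/-- The elementary symmetric polynomial of degree `s` in `z 0, …, z (n - 1)`. -/
def elemSymm (z : ℕ → ℤ) : ℕ → ℕ → ℤ
  | 0, _ => 1
  | _ + 1, 0 => 0
  | s + 1, n + 1 => elemSymm z (s + 1) n + z n * elemSymm z s n

/-- The recurrence splits the sets according to whether they contain the last index. -/
theorem elemSymm_eq_sum (z : ℕ → ℤ) (s n : ℕ) :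
    elemSymm z s n = ∑ S ∈ (Finset.range n).powersetCard s, ∏ j ∈ S, z j := by
  induction n generalizing s with
  | zero =>
    cases s with
    | zero => simp [elemSymm]
    | succ s => rw [Finset.powersetCard_eq_empty.2 (by simp)]; simp [elemSymm]
  | succ n ih =>
    cases s with
    | zero => simp [elemSymm]
    | succ s =>
      have hn : ∀ S ∈ (Finset.range n).powersetCard s, n ∉ S := fun S hS hc => by
        have := (Finset.mem_powersetCard.1 hS).1 hc
        simp at this
      rw [elemSymm, ih, ih, Finset.range_add_one,
        Finset.powersetCard_succ_insert Finset.notMem_range_self, Finset.sum_union,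
        Finset.sum_image, Finset.mul_sum]
      · congr 1
        exact Finset.sum_congr rfl fun S hS => (Finset.prod_insert (hn S hS)).symm
      · intro S hS S' hS' h
        rw [← Finset.erase_insert (hn S hS), ← Finset.erase_insert (hn S' hS'), h]
      · rw [Finset.disjoint_left]
        intro S hS hS'
        obtain ⟨S', _, rfl⟩ := Finset.mem_image.1 hS'
        have := (Finset.mem_powersetCard.1 hS).1 (Finset.mem_insert_self n S')
        simp at this

theorem elemSymm_eq_sum_fin (z : ℕ → ℤ) (s n : ℕ) :
    elemSymm z s n = ∑ S ∈ (Finset.univ : Finset (Fin n)).powersetCard s, ∏ j ∈ S, z j := by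
  rw [elemSymm_eq_sum, ← Nat.Iio_eq_range, ← Fin.map_valEmbedding_univ, Finset.powersetCard_map, Finset.sum_map]
  refine Finset.sum_congr rfl fun S _ => ?_
  simp [Finset.mapEmbedding_apply]

/-! ### The program

Registers: `0` and `1` hold `n` and `k`, `2` and `3` the constants `1` and `0`, `4` and `6` the
loop counters for the two rows, `5` and `7` the addresses of the two rows, `8` and `9` the
numerator and denominator, `10` the counter of coordinates, `11` and `12` the addresses of the
current coordinates, `13` their product, and `20 + s` the elementary symmetric polynomial of
degree `s` in the products seen so far. -/

/-- Load the product of two signs at the current addresses. -/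
def loadProduct : Prog :=
  .seq (.load 13 11) (.seq (.load 14 12) (.ifPos 13 (.add 13 14 3) (.sub 13 3 14)))

/-- Initialize the elementary symmetric polynomials of degree at most `b`. -/
def initSymm : ℕ → Prog
  | 0 => .const 20 1
  | b + 1 => .seq (.const (21 + b) 0) (initSymm b)

/-- Update the elementary symmetric polynomials of degree at most `b` by one more sign. -/
def updateSymm : ℕ → Prog
  | 0 => .const 15 0
  | b + 1 => .seq (.ifPos 13 (.add (21 + b) (21 + b) (20 + b)) (.sub (21 + b) (21 + b) (20 + b)))
      (updateSymm b)

/-- Add the signed elementary symmetric polynomials of degree less than `b` to the numerator. -/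
def accumulate : ℕ → Prog
  | 0 => .const 15 0
  | b + 1 => .seq (.ifPos 13 (.add 8 8 (20 + b)) (.sub 8 8 (20 + b))) (accumulate b)

/-- Process one coordinate. -/
def coordStep (b : ℕ) : Prog :=
  .seq loadProduct (.seq (updateSymm b)
    (.seq (.add 11 11 2) (.seq (.add 12 12 2) (.sub 10 10 2))))

/-- Preparations for one pair of rows. -/
def pairInit (b : ℕ) : Prog :=
  .seq (.add 10 0 3) (.seq (.add 11 5 3) (.seq (.add 12 7 3) (initSymm b)))

/-- Conclusion for one pair of rows. -/
def pairFinish (b : ℕ) : Prog :=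
  .seq loadProduct (.seq (accumulate (b + 1))
    (.seq (.add 9 9 2) (.seq (.add 7 7 0) (.seq (.add 7 7 2) (.sub 6 6 2)))))

/-- Process one pair of rows. -/
def pairStep (b : ℕ) : Prog :=
  .seq (pairInit b) (.seq (.whilePos 10 (coordStep b)) (pairFinish b))

/-- Process all pairs with a given first row. -/
def rowStep (b : ℕ) : Prog :=
  .seq (.seq (.add 6 1 3) (.const 7 0)) (.seq (.whilePos 6 (pairStep b))
    (.seq (.add 5 5 0) (.seq (.add 5 5 2) (.sub 4 4 2))))

/-- Compute the estimator for the characters of degree at most `b`. -/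
def estimatorProg (b : ℕ) : Prog :=
  .seq (.seq (.const 2 1) (.add 4 1 3)) (.seq (.whilePos 4 (rowStep b))
    (.seq (.add 0 8 3) (.add 1 9 3)))

theorem loopFree_initSymm : ∀ b, (initSymm b).LoopFree
  | 0 => trivial
  | b + 1 => ⟨trivial, loopFree_initSymm b⟩

theorem loopFree_updateSymm : ∀ b, (updateSymm b).LoopFree
  | 0 => trivial
  | b + 1 => ⟨⟨trivial, trivial⟩, loopFree_updateSymm b⟩

theorem loopFree_accumulate : ∀ b, (accumulate b).LoopFree
  | 0 => trivial
  | b + 1 => ⟨⟨trivial, trivial⟩, loopFree_accumulate b⟩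

theorem loopFree_coordStep (b : ℕ) : (coordStep b).LoopFree :=
  ⟨⟨trivial, trivial, trivial, trivial⟩, loopFree_updateSymm b, trivial, trivial, trivial⟩

theorem loopFree_pairInit (b : ℕ) : (pairInit b).LoopFree :=
  ⟨trivial, trivial, trivial, loopFree_initSymm b⟩

theorem loopFree_pairFinish (b : ℕ) : (pairFinish b).LoopFree :=
  ⟨⟨trivial, trivial, trivial, trivial⟩, loopFree_accumulate _, trivial, trivial, trivial, trivial⟩

theorem initSymm_mem (b : ℕ) (s : RamState) : ((initSymm b).run s).mem = s.mem := by
  induction b generalizing s with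
  | zero => rfl
  | succ b ih => rw [initSymm, Prog.run, ih]; rfl

theorem initSymm_reg (b : ℕ) (s : RamState) (r : ℕ) : ((initSymm b).run s).reg r =
    if r = 20 then 1 else if 21 ≤ r ∧ r ≤ 20 + b then 0 else s.reg r := by
  induction b generalizing s with
  | zero =>
    simp only [initSymm, Prog.run, Function.update_apply]
    split_ifs <;> first | rfl | omega
  | succ b ih =>
    rw [initSymm, Prog.run, ih]
    simp only [Prog.run, Function.update_apply]
    split_ifs <;> first | rfl | omega

theorem updateSymm_mem (b : ℕ) (s : RamState) : ((updateSymm b).run s).mem = s.mem := by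
  induction b generalizing s with
  | zero => rfl
  | succ b ih =>
    rw [updateSymm, Prog.run, ih]
    simp only [Prog.run]
    split_ifs <;> rfl

/-- Degrees are updated from the highest down, so `reg (r - 1)` still holds its old value when `reg
r` is changed. As `reg 13` is a sign, adding or subtracting replaces the multiplication. -/
theorem updateSymm_reg (b : ℕ) (s : RamState) (hz : s.reg 13 = 1 ∨ s.reg 13 = -1) (r : ℕ) :
    ((updateSymm b).run s).reg r =
      if r = 15 then 0 else
      if 21 ≤ r ∧ r ≤ 20 + b then s.reg r + s.reg 13 * s.reg (r - 1) else s.reg r := by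
  induction b generalizing s with
  | zero =>
    simp only [updateSymm, Prog.run, Function.update_apply]
    split_ifs <;> first | rfl | omega
  | succ b ih =>
    have h1 : ((Prog.ifPos 13 (.add (21 + b) (21 + b) (20 + b))
        (.sub (21 + b) (21 + b) (20 + b))).run s).reg =
        Function.update s.reg (21 + b) (s.reg (21 + b) + s.reg 13 * s.reg (20 + b)) := by
      simp only [Prog.run]
      rcases hz with h | h <;> rw [h] <;> norm_num
      rfl
    have h13 : (13 : ℕ) ≠ 21 + b := by omega
    rw [updateSymm, Prog.run, ih _ (by rw [h1, Function.update_of_ne h13]; exact hz), h1,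
      Function.update_of_ne h13]
    simp only [Function.update_apply]
    split_ifs <;> first | rfl | omega | skip
    subst_vars
    congr 3
    omega

theorem accumulate_mem (b : ℕ) (s : RamState) : ((accumulate b).run s).mem = s.mem := by
  induction b generalizing s with
  | zero => rfl
  | succ b ih =>
    rw [accumulate, Prog.run, ih]
    simp only [Prog.run]
    split_ifs <;> rfl

theorem accumulate_reg (b : ℕ) (s : RamState) (hz : s.reg 13 = 1 ∨ s.reg 13 = -1) (r : ℕ) :
    ((accumulate b).run s).reg r =
      if r = 15 then 0 else
      if r = 8 then s.reg 8 + s.reg 13 * ∑ i ∈ Finset.range b, s.reg (20 + i) else s.reg r := by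
  induction b generalizing s with
  | zero =>
    simp only [accumulate, Prog.run, Function.update_apply]
    split_ifs <;> simp_all
  | succ b ih =>
    have h1 : ((Prog.ifPos 13 (.add 8 8 (20 + b)) (.sub 8 8 (20 + b))).run s).reg =
        Function.update s.reg 8 (s.reg 8 + s.reg 13 * s.reg (20 + b)) := by
      simp only [Prog.run]
      rcases hz with h | h <;> rw [h] <;> norm_num
      rfl
    have h13 : (13 : ℕ) ≠ 8 := by omega
    rw [accumulate, Prog.run, ih _ (by rw [h1, Function.update_of_ne h13]; exact hz), h1,
      Function.update_of_ne h13, Function.update_self]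
    have h2 : ∀ i, Function.update s.reg 8 (s.reg 8 + s.reg 13 * s.reg (20 + b)) (20 + i) =
        s.reg (20 + i) := fun i => Function.update_of_ne (by omega) _ _
    simp only [h2, Function.update_apply]
    split_ifs
    · rfl
    · rw [Finset.sum_range_succ]; ring
    · rfl

theorem loadProduct_mem (s : RamState) : (loadProduct.run s).mem = s.mem :=
  (apply_ite RamState.mem _ _ _).trans (ite_self _)

theorem loadProduct_reg (s : RamState) (h3 : s.reg 3 = 0) {u v : ℤ}
    (hu : s.mem (s.reg 11).toNat = u) (hv : s.mem (s.reg 12).toNat = v)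
    (hu1 : u = 1 ∨ u = -1) (r : ℕ) :
    (loadProduct.run s).reg r =
      if r = 13 then u * v else if r = 14 then v else s.reg r := by
  simp only [loadProduct, Prog.run]
  simp [hu, hv, h3]
  rcases hu1 with rfl | rfl <;> simp [Function.update_apply] <;> split_ifs <;> simp_all

end ExpectedDiameter

namespace ExpectedDiameter

/-! ### Execution of the program and loop invariants -/

theorem coordStep_run {b : ℕ} {s : RamState} (h2 : s.reg 2 = 1) (h3 : s.reg 3 = 0) {u v : ℤ}
    (hu : s.mem (s.reg 11).toNat = u) (hv : s.mem (s.reg 12).toNat = v)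
    (hu1 : u = 1 ∨ u = -1) (hv1 : v = 1 ∨ v = -1) :
    ((coordStep b).run s).mem = s.mem ∧ (∀ r < 10, ((coordStep b).run s).reg r = s.reg r) ∧
      ((coordStep b).run s).reg 10 = s.reg 10 - 1 ∧
      ((coordStep b).run s).reg 11 = s.reg 11 + 1 ∧
      ((coordStep b).run s).reg 12 = s.reg 12 + 1 ∧
      ((coordStep b).run s).reg 20 = s.reg 20 ∧
      ∀ t < b, ((coordStep b).run s).reg (20 + (t + 1)) =
        s.reg (20 + (t + 1)) + u * v * s.reg (20 + t) := by
  have e1 := loadProduct_reg s h3 hu hv hu1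
  have hz : (loadProduct.run s).reg 13 = 1 ∨ (loadProduct.run s).reg 13 = -1 := by
    rw [e1, if_pos rfl]
    rcases hu1 with rfl | rfl <;> rcases hv1 with rfl | rfl <;> simp
  have e2 := updateSymm_reg b _ hz
  simp only [e1] at e2
  refine ⟨?_, fun r hr => ?_, ?_, ?_, ?_, ?_, fun t ht => ?_⟩
  · simp only [coordStep, Prog.run, updateSymm_mem, loadProduct_mem]
  · have hr15 : r ≠ 15 := by omega
    have hr10 : r ≠ 10 := by omega
    have hr11 : r ≠ 11 := by omega
    have hr12 : r ≠ 12 := by omega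
    have hr13 : r ≠ 13 := by omega
    have hr14 : r ≠ 14 := by omega
    have hr21 : ¬ (21 ≤ r ∧ r ≤ 20 + b) := by omega
    simp only [coordStep, Prog.run, Function.update_apply, e2, hr15, hr10, hr11, hr12, hr13, hr14,
      hr21, if_false]
  · simp [coordStep, Prog.run, e2, h2]
  · simp [coordStep, Prog.run, e2, h2]
  · simp [coordStep, Prog.run, e2, h2]
  · simp [coordStep, Prog.run, e2]
  · have h21 : 21 ≤ 20 + (t + 1) ∧ 20 + (t + 1) ≤ 20 + b := by omega
    have a10 : 20 + (t + 1) ≠ 10 := by omega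
    have a11 : 20 + (t + 1) ≠ 11 := by omega
    have a12 : 20 + (t + 1) ≠ 12 := by omega
    have a13 : 20 + (t + 1) ≠ 13 := by omega
    have a14 : 20 + (t + 1) ≠ 14 := by omega
    have a15 : 20 + (t + 1) ≠ 15 := by omega
    have b13 : 20 + t ≠ 13 := by omega
    have b14 : 20 + t ≠ 14 := by omega
    have hsub : 20 + (t + 1) - 1 = 20 + t := by omega
    simp only [coordStep, Prog.run, Function.update_apply, e2, h21, a10, a11, a12, a13, a14, a15,
      hsub, b13, b14, if_false, if_true, and_self]

theorem pairInit_run {b : ℕ} {s : RamState} (h3 : s.reg 3 = 0) :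
    ((pairInit b).run s).mem = s.mem ∧ (∀ r < 10, ((pairInit b).run s).reg r = s.reg r) ∧
      ((pairInit b).run s).reg 10 = s.reg 0 ∧
      ((pairInit b).run s).reg 11 = s.reg 5 ∧
      ((pairInit b).run s).reg 12 = s.reg 7 ∧
      ∀ t ≤ b, ((pairInit b).run s).reg (20 + t) = if t = 0 then 1 else 0 := by
  refine ⟨?_, fun r hr => ?_, ?_, ?_, ?_, fun t ht => ?_⟩
  · simp only [pairInit, Prog.run, initSymm_mem]
  · have hr20 : r ≠ 20 := by omega
    have hr10 : r ≠ 10 := by omega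
    have hr11 : r ≠ 11 := by omega
    have hr12 : r ≠ 12 := by omega
    have hr21 : ¬ (21 ≤ r ∧ r ≤ 20 + b) := by omega
    simp only [pairInit, Prog.run, initSymm_reg, Function.update_apply, hr20, hr10, hr11, hr12,
      hr21, if_false]
  · simp [pairInit, Prog.run, initSymm_reg, h3]
  · simp [pairInit, Prog.run, initSymm_reg, h3]
  · simp [pairInit, Prog.run, initSymm_reg, h3]
  · simp only [pairInit, Prog.run, initSymm_reg]
    split_ifs <;> first | rfl | omega

theorem pairFinish_run {b : ℕ} {s : RamState} (h2 : s.reg 2 = 1) (h3 : s.reg 3 = 0) {u v : ℤ}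
    (hu : s.mem (s.reg 11).toNat = u) (hv : s.mem (s.reg 12).toNat = v)
    (hu1 : u = 1 ∨ u = -1) (hv1 : v = 1 ∨ v = -1) :
    ((pairFinish b).run s).mem = s.mem ∧ (∀ r < 6, ((pairFinish b).run s).reg r = s.reg r) ∧
      ((pairFinish b).run s).reg 6 = s.reg 6 - 1 ∧
      ((pairFinish b).run s).reg 7 = s.reg 7 + s.reg 0 + 1 ∧
      ((pairFinish b).run s).reg 8 =
        s.reg 8 + u * v * ∑ t ∈ Finset.range (b + 1), s.reg (20 + t) ∧
      ((pairFinish b).run s).reg 9 = s.reg 9 + 1 := by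
  have e1 := loadProduct_reg s h3 hu hv hu1
  have hz : (loadProduct.run s).reg 13 = 1 ∨ (loadProduct.run s).reg 13 = -1 := by
    rw [e1, if_pos rfl]
    rcases hu1 with rfl | rfl <;> rcases hv1 with rfl | rfl <;> simp
  have e2 := accumulate_reg (b + 1) _ hz
  have h20 : ∀ t, (loadProduct.run s).reg (20 + t) = s.reg (20 + t) := fun t => by
    rw [e1, if_neg (by omega), if_neg (by omega)]
  simp only [h20] at e2
  simp only [e1] at e2
  refine ⟨?_, fun r hr => ?_, ?_, ?_, ?_, ?_⟩
  · simp only [pairFinish, Prog.run, accumulate_mem, loadProduct_mem]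
  · have hr15 : r ≠ 15 := by omega
    have hr6 : r ≠ 6 := by omega
    have hr7 : r ≠ 7 := by omega
    have hr8 : r ≠ 8 := by omega
    have hr9 : r ≠ 9 := by omega
    have hr13 : r ≠ 13 := by omega
    have hr14 : r ≠ 14 := by omega
    simp only [pairFinish, Prog.run, Function.update_apply, e2, hr15, hr6, hr7, hr8, hr9, hr13,
      hr14, if_false]
  all_goals simp [pairFinish, Prog.run, e2, h2]

/-- The contribution of the rows at the addresses `p` and `q` to the numerator. -/
def kernel (b n : ℕ) (M : ℕ → ℤ) (p q : ℕ) : ℤ :=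
  M (p + n) * M (q + n) * ∑ t ∈ Finset.range (b + 1), elemSymm (fun m => M (p + m) * M (q + m)) t n

/-- A time bound for one pair of rows. -/
def pairCost (b n : ℕ) : ℕ :=
  (pairInit b).size + ((n * ((coordStep b).size + 1) + 1) + (pairFinish b).size)

theorem pairStep_halts (b : ℕ) {n p q : ℕ} {s : RamState} (h0 : s.reg 0 = n) (h2 : s.reg 2 = 1)
    (h3 : s.reg 3 = 0) (h5 : s.reg 5 = p) (h7 : s.reg 7 = q)
    (hp : ∀ m ≤ n, s.mem (p + m) = 1 ∨ s.mem (p + m) = -1)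
    (hq : ∀ m ≤ n, s.mem (q + m) = 1 ∨ s.mem (q + m) = -1) :
    Halts (pairStep b) s (pairCost b n) fun s' => s'.mem = s.mem ∧ (∀ r < 6, s'.reg r = s.reg r) ∧
      s'.reg 6 = s.reg 6 - 1 ∧ s'.reg 7 = q + n + 1 ∧
      s'.reg 8 = s.reg 8 + kernel b n s.mem p q ∧ s'.reg 9 = s.reg 9 + 1 := by
  -- After `c` coordinates the registers from `20` on hold the elementary symmetric polynomials of
  -- the first `c` products.
  let I : ℕ → RamState → Prop := fun c s' => s'.mem = s.mem ∧ (∀ r < 10, s'.reg r = s.reg r) ∧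
    s'.reg 10 = (n : ℤ) - c ∧ s'.reg 11 = p + c ∧ s'.reg 12 = q + c ∧
    ∀ t ≤ b, s'.reg (20 + t) = elemSymm (fun m => s.mem (p + m) * s.mem (q + m)) t c
  have haddr : ∀ x y : ℕ, ((x : ℤ) + y).toNat = x + y := fun x y => by omega
  refine Halts.seq (Q := I 0) ((loopFree_pairInit b).halts ?_) fun s1 hs1 =>
    Halts.seq (Q := I n) (Halts.whilePos (I := I) (fun c s' _ hs' => hs'.2.2.1)
      (fun c s' hc hs' => (loopFree_coordStep b).halts ?_) hs1) fun s2 hs2 =>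
      (loopFree_pairFinish b).halts ?_
  · obtain ⟨c1, c2, c3, c4, c5, c6⟩ := pairInit_run (b := b) h3
    refine ⟨c1, c2, by simp [c3, h0], by simp [c4, h5], by simp [c5, h7], fun t ht => ?_⟩
    rw [c6 t ht]
    cases t <;> simp [elemSymm]
  · obtain ⟨i1, i2, i3, i4, i5, i6⟩ := hs'
    obtain ⟨c1, c2, c3, c4, c5, c6, c7⟩ := coordStep_run (b := b) (s := s')
      (u := s.mem (p + c)) (v := s.mem (q + c))
      (by rw [i2 _ (by norm_num), h2]) (by rw [i2 _ (by norm_num), h3])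
      (by rw [i1, i4, haddr]) (by rw [i1, i5, haddr]) (hp c hc.le) (hq c hc.le)
    refine ⟨c1.trans i1, fun r hr => (c2 r hr).trans (i2 r hr), ?_, ?_, ?_, fun t ht => ?_⟩
    · rw [c3, i3]; push_cast; ring
    · rw [c4, i4]; push_cast; ring
    · rw [c5, i5]; push_cast; ring
    · cases t with
      | zero => rw [Nat.add_zero, c6]; exact (i6 0 (Nat.zero_le _)).trans (by simp [elemSymm])
      | succ t => rw [c7 t (by omega), i6 _ ht, i6 t (by omega), elemSymm]
  · obtain ⟨i1, i2, i3, i4, i5, i6⟩ := hs2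
    -- After `n` coordinates both addresses point at the labels, so the same loading code now yields
    -- the product of the labels.
    obtain ⟨c1, c2, c3, c4, c5, c6⟩ := pairFinish_run (b := b) (s := s2)
      (u := s.mem (p + n)) (v := s.mem (q + n))
      (by rw [i2 _ (by norm_num), h2]) (by rw [i2 _ (by norm_num), h3])
      (by rw [i1, i4, haddr]) (by rw [i1, i5, haddr]) (hp n le_rfl) (hq n le_rfl)
    refine ⟨c1.trans i1, fun r hr => (c2 r hr).trans (i2 r (by omega)), ?_, ?_, ?_, ?_⟩
    · rw [c3, i2 _ (by norm_num)]
    · rw [c4, i2 _ (by norm_num), i2 _ (by norm_num), h7, h0]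
    · rw [c5, i2 _ (by norm_num), kernel]
      congr 2
      exact Finset.sum_congr rfl fun t ht => i6 t (by simpa [Nat.lt_succ_iff] using ht)
    · rw [c6, i2 _ (by norm_num)]

/-- A time bound for one row. -/
def rowCost (b n k : ℕ) : ℕ := 2 + ((k * (pairCost b n + 1) + 1) + 3)

theorem rowStep_halts (b : ℕ) {n k p : ℕ} {s : RamState} (h0 : s.reg 0 = n) (h1 : s.reg 1 = k)
    (h2 : s.reg 2 = 1) (h3 : s.reg 3 = 0) (h5 : s.reg 5 = p)
    (hp : ∀ m ≤ n, s.mem (p + m) = 1 ∨ s.mem (p + m) = -1)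
    (hM : ∀ j < k, ∀ m ≤ n, s.mem (j * (n + 1) + m) = 1 ∨ s.mem (j * (n + 1) + m) = -1) :
    Halts (rowStep b) s (rowCost b n k) fun s' => s'.mem = s.mem ∧ (∀ r < 4, s'.reg r = s.reg r) ∧
      s'.reg 4 = s.reg 4 - 1 ∧ s'.reg 5 = p + n + 1 ∧
      s'.reg 8 = s.reg 8 + ∑ j ∈ Finset.range k, kernel b n s.mem p (j * (n + 1)) ∧
      s'.reg 9 = s.reg 9 + k := by
  -- Rows have length `n + 1`, label included, so the second row has address `c * (n + 1)` after `c`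
  -- pairs.
  let I : ℕ → RamState → Prop := fun c s' => s'.mem = s.mem ∧ (∀ r < 6, s'.reg r = s.reg r) ∧
    s'.reg 6 = (k : ℤ) - c ∧ s'.reg 7 = (c * (n + 1) : ℕ) ∧
    s'.reg 8 = s.reg 8 + ∑ j ∈ Finset.range c, kernel b n s.mem p (j * (n + 1)) ∧
    s'.reg 9 = s.reg 9 + c
  refine Halts.seq (Q := I 0) (Prog.LoopFree.halts (by exact ⟨trivial, trivial⟩) ?_) fun s1 hs1 =>
    Halts.seq (Q := I k) (Halts.whilePos (I := I) (fun c s' _ hs' => hs'.2.2.1)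
      (fun c s' hc hs' => ?_) hs1) fun s2 hs2 =>
      Prog.LoopFree.halts (by exact ⟨trivial, trivial, trivial⟩) ?_
  · refine ⟨rfl, fun r hr => ?_, ?_, ?_, ?_, ?_⟩
    · have hr6 : r ≠ 6 := by omega
      have hr7 : r ≠ 7 := by omega
      simp only [Prog.run, Function.update_apply, hr6, hr7, if_false]
    all_goals simp [Prog.run, h1, h3]
  · obtain ⟨i1, i2, i3, i4, i5, i6⟩ := hs'
    refine (pairStep_halts b (p := p) (q := c * (n + 1)) ?_ ?_ ?_ ?_ i4 ?_ ?_).mono le_rfl ?_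
    · rw [i2 _ (by norm_num), h0]
    · rw [i2 _ (by norm_num), h2]
    · rw [i2 _ (by norm_num), h3]
    · rw [i2 _ (by norm_num), h5]
    · rw [i1]; exact hp
    · rw [i1]; exact hM c hc
    · rintro s'' ⟨c1, c2, c3, c4, c5, c6⟩
      refine ⟨c1.trans i1, fun r hr => (c2 r hr).trans (i2 r hr), ?_, ?_, ?_, ?_⟩
      · rw [c3, i3]; push_cast; ring
      · rw [c4]; push_cast; ring
      · rw [c5, i5, i1, Finset.sum_range_succ, add_assoc]
      · rw [c6, i6]; push_cast; ring
  · obtain ⟨i1, i2, i3, i4, i5, i6⟩ := hs2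
    refine ⟨i1, fun r hr => ?_, ?_, ?_, ?_, ?_⟩
    · have hr4 : r ≠ 4 := by omega
      have hr5 : r ≠ 5 := by omega
      simp only [Prog.run, Function.update_apply, hr4, hr5, if_false]
      exact i2 r (by omega)
    · simp [Prog.run, i2, h2]
    · simp [Prog.run, i2, h2, h5, h0]
    · simpa [Prog.run] using i5
    · simpa [Prog.run] using i6

/-- A time bound for the whole program. -/
def totalCost (b n k : ℕ) : ℕ := 2 + ((k * (rowCost b n k + 1) + 1) + 2)

theorem estimatorProg_halts (b : ℕ) {n k : ℕ} {s : RamState} (h0 : s.reg 0 = n) (h1 : s.reg 1 = k)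
    (hs : ∀ r, 2 ≤ r → s.reg r = 0)
    (hM : ∀ j < k, ∀ m ≤ n, s.mem (j * (n + 1) + m) = 1 ∨ s.mem (j * (n + 1) + m) = -1) :
    Halts (estimatorProg b) s (totalCost b n k) fun s' =>
      s'.reg 0 = ∑ i ∈ Finset.range k, ∑ j ∈ Finset.range k,
        kernel b n s.mem (i * (n + 1)) (j * (n + 1)) ∧
      s'.reg 1 = k * k := by
  let I : ℕ → RamState → Prop := fun c s' => s'.mem = s.mem ∧ s'.reg 0 = n ∧ s'.reg 1 = k ∧
    s'.reg 2 = 1 ∧ s'.reg 3 = 0 ∧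
    s'.reg 4 = (k : ℤ) - c ∧ s'.reg 5 = (c * (n + 1) : ℕ) ∧
    s'.reg 8 = ∑ i ∈ Finset.range c, ∑ j ∈ Finset.range k,
      kernel b n s.mem (i * (n + 1)) (j * (n + 1)) ∧
    s'.reg 9 = c * k
  refine Halts.seq (Q := I 0) (Prog.LoopFree.halts (by exact ⟨trivial, trivial⟩) ?_) fun s1 hs1 =>
    Halts.seq (Q := I k) (Halts.whilePos (I := I) (fun c s' _ hs' => hs'.2.2.2.2.2.1)
      (fun c s' hc hs' => ?_) hs1) fun s2 hs2 =>
      Prog.LoopFree.halts (by exact ⟨trivial, trivial⟩) ?_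
  · simp [I, Prog.run, h0, h1, hs]
  · obtain ⟨i0, i1, i2, i3, i4, i5, i6, i7, i8⟩ := hs'
    refine (rowStep_halts b i1 i2 i3 i4 i6 ?_ ?_).mono le_rfl ?_
    · rw [i0]; exact hM c hc
    · rw [i0]; exact hM
    · rintro s'' ⟨c1, c2, c3, c4, c5, c6⟩
      refine ⟨c1.trans i0, (c2 0 (by norm_num)).trans i1, (c2 1 (by norm_num)).trans i2,
        (c2 2 (by norm_num)).trans i3, (c2 3 (by norm_num)).trans i4, ?_, ?_, ?_, ?_⟩
      · rw [c3, i5]; push_cast; ring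
      · rw [c4]; push_cast; ring
      · rw [c5, i7, i0, Finset.sum_range_succ]
      · rw [c6, i8]; push_cast; ring
  · obtain ⟨i0, i1, i2, i3, i4, i5, i6, i7, i8⟩ := hs2
    simp [Prog.run, i7, i8, i4]

/-! ### Correctness of the program -/

variable {n k : ℕ}

theorem inputState_mem_coord (D : Dataset n k) (i : Fin k) (j : Fin n) :
    (inputState D).mem (i * (n + 1) + j) = ((D.1 i j : ℤˣ) : ℤ) := by
  have h1 : (i * (n + 1) + j : ℕ) / (n + 1) = i := by
    rw [mul_comm, Nat.mul_add_div (by omega), Nat.div_eq_of_lt (by omega), add_zero]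
  have h2 : (i * (n + 1) + j : ℕ) % (n + 1) = j := by
    rw [mul_comm, Nat.mul_add_mod, Nat.mod_eq_of_lt (by omega)]
  simp [inputState, h1, h2]

theorem inputState_mem_label (D : Dataset n k) (i : Fin k) :
    (inputState D).mem (i * (n + 1) + n) = ((D.2 i : ℤˣ) : ℤ) := by
  have h1 : (i * (n + 1) + n : ℕ) / (n + 1) = i := by
    rw [mul_comm, Nat.mul_add_div (by omega), Nat.div_eq_of_lt (by omega), add_zero]
  have h2 : (i * (n + 1) + n : ℕ) % (n + 1) = n := by
    rw [mul_comm, Nat.mul_add_mod, Nat.mod_eq_of_lt (by omega)]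
  simp [inputState, h1, h2]

theorem inputState_mem_sign (D : Dataset n k) {i : ℕ} (hi : i < k) {m : ℕ} (hm : m ≤ n) :
    (inputState D).mem (i * (n + 1) + m) = 1 ∨ (inputState D).mem (i * (n + 1) + m) = -1 := by
  have hu : ∀ v : ℤˣ, (v : ℤ) = 1 ∨ (v : ℤ) = -1 := fun v => by
    rcases Int.units_eq_one_or v with rfl | rfl <;> simp
  rcases hm.lt_or_eq with hm | rfl
  · have := inputState_mem_coord D ⟨i, hi⟩ ⟨m, hm⟩
    simp only at this
    rw [this]; exact hu _
  · have := inputState_mem_label D ⟨i, hi⟩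
    simp only at this
    rw [this]; exact hu _

/-- Grouping the sets by size turns the sum of `χ_S(x_i) χ_S(x_j)` into elementary symmetric
polynomials of the coordinatewise products. -/
theorem kernel_inputState (b : ℕ) (D : Dataset n k) (i j : Fin k) :
    (kernel b n (inputState D).mem (i * (n + 1)) (j * (n + 1)) : ℝ) =
      ∑ S : Finset (Fin n) with S.card < b + 1,
        (character S (D.1 i) * toReal (D.2 i)) * (character S (D.1 j) * toReal (D.2 j)) := by
  have hsum : ∀ f : Finset (Fin n) → ℝ, ∑ S with S.card < b + 1, f S =
      ∑ t ∈ Finset.range (b + 1), ∑ S ∈ Finset.univ.powersetCard t, f S := fun f => by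
    rw [← Finset.sum_fiberwise_of_maps_to (t := Finset.range (b + 1)) (g := Finset.card)
      (by simp)]
    refine Finset.sum_congr rfl fun t ht => Finset.sum_congr ?_ fun _ _ => rfl
    ext S
    simp only [Finset.mem_filter, Finset.mem_univ, true_and, Finset.mem_powersetCard,
      Finset.subset_univ, Finset.mem_range] at ht ⊢
    omega
  rw [hsum, kernel, inputState_mem_label, inputState_mem_label]
  push_cast
  rw [Finset.mul_sum]
  refine Finset.sum_congr rfl fun t _ => ?_
  rw [elemSymm_eq_sum_fin]
  push_cast
  rw [Finset.mul_sum]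
  refine Finset.sum_congr rfl fun S _ => ?_
  simp_rw [inputState_mem_coord]
  rw [Finset.prod_mul_distrib]
  simp only [character, toReal]
  ring

theorem estimator_eq (b : ℕ) (D : Dataset n k) :
    estimator (b + 1) D = ((∑ i ∈ Finset.range k, ∑ j ∈ Finset.range k,
      kernel b n (inputState D).mem (i * (n + 1)) (j * (n + 1)) : ℤ) : ℝ) / (k * k) := by
  rw [Finset.sum_range]
  simp_rw [Finset.sum_range]
  push_cast
  simp_rw [kernel_inputState]
  rw [estimator, div_eq_inv_mul]
  simp_rw [Finset.sum_comm (t := Finset.filter _ _), ← Finset.sum_mul_sum]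
  rw [Finset.mul_sum]
  refine Finset.sum_congr rfl fun S _ => ?_
  rw [empirical, mul_pow, one_div, mul_inv, ← sq, ← sq]

/-- The estimator is computable in polynomial time. -/
theorem exists_computesWithin_estimator {a : ℕ} (ha : 0 < a) :
    ∃ (P : Prog) (T : Polynomial ℕ), ComputesWithin P T (fun _ _ D => estimator a D) := by
  obtain ⟨b, rfl⟩ := Nat.exists_eq_add_one_of_ne_zero ha.ne'
  -- These are the cost bounds with `n` and `k` both replaced by the variable, which stands for `n +
  -- k`; `b` is fixed, so the program sizes are constants.
  let Tp : Polynomial ℕ := .C (pairInit b).size +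
    ((.X * (.C ((coordStep b).size + 1)) + 1) + .C (pairFinish b).size)
  let Tr : Polynomial ℕ := 2 + ((.X * (Tp + 1) + 1) + 3)
  refine ⟨estimatorProg b, 2 + ((.X * (Tr + 1) + 1) + 2), fun n k D hk => ?_⟩
  obtain ⟨t, s, he, ht, hs0, hs1⟩ := estimatorProg_halts b (n := n) (k := k) (s := inputState D)
    rfl rfl (fun r hr => by simp [inputState, show r ≠ 0 by omega, show r ≠ 1 by omega])
    (fun j hj m hm => inputState_mem_sign D hj hm)
  refine ⟨t, s, he, ht.trans ?_, ?_, ?_⟩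
  · simp only [totalCost, rowCost, pairCost, Tr, Tp, Polynomial.eval_add, Polynomial.eval_mul,
      Polynomial.eval_X, Polynomial.eval_C, Polynomial.eval_one, Polynomial.eval_ofNat]
    gcongr <;> omega
  · rw [hs1]; positivity
  · rw [hs0, hs1, Int.cast_mul, Int.cast_natCast]
    exact (estimator_eq b D).symm

end ExpectedDiameter

namespace ExpectedDiameter

variable {n k : ℕ}

/-! ### Mixtures of halfspaces -/

theorem innerProd_eq_sum_fourier (f g : Cube n → ℤˣ) :
    innerProd f g = ∑ S, fourier (fun x => toReal (f x)) S * fourier (fun x => toReal (g x)) S :=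
  (parseval _ _).symm

/-- Independence makes the mean of a product of coefficients the square of the mean coefficient. -/
theorem expectedInner_eq_sum_sq (p : (Cube n → ℤˣ) → ℝ) :
    expectedInner p = ∑ S, (∑ h, p h * fourier (fun x => toReal (h x)) S) ^ 2 := by
  simp_rw [sq, Finset.sum_mul_sum]
  rw [Finset.sum_comm]
  simp_rw [Finset.sum_comm (s := (Finset.univ : Finset (Finset (Fin n))))]
  refine Finset.sum_congr rfl fun h₁ _ => Finset.sum_congr rfl fun h₂ _ => ?_
  rw [innerProd_eq_sum_fourier, Finset.mul_sum]
  exact Finset.sum_congr rfl fun S _ => by ring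

variable {H : Set (Cube n → ℤˣ)} {p : (Cube n → ℤˣ) → ℝ}

/-- Cauchy–Schwarz on the support: `1 = (∑ p)² ≤ |H| ∑ p²`. -/
theorem IsDistributionOn.one_le_concentration (hp : IsDistributionOn H p) :
    1 ≤ concentration H p := by
  classical
  have h1 : ∑ h ∈ H.toFinset, p h = 1 := by
    rw [← hp.total]
    refine Finset.sum_subset (Finset.subset_univ _) fun h _ hh => hp.support h ?_
    simpa using hh
  have h2 : ∑ h ∈ H.toFinset, p h ^ 2 ≤ ∑ h, p h ^ 2 :=
    Finset.sum_le_sum_of_subset_of_nonneg (Finset.subset_univ _) fun _ _ _ => sq_nonneg _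
  have h3 := sq_sum_le_card_mul_sum_sq (s := H.toFinset) (f := p)
  rw [h1, one_pow] at h3
  rw [concentration, Set.ncard_eq_toFinset_card']
  exact h3.trans (by gcongr)

theorem IsDistributionOn.sum_mul_le (hp : IsDistributionOn H p) {f : (Cube n → ℤˣ) → ℝ} {c : ℝ}
    (hf : ∀ h ∈ H, f h ≤ c) : ∑ h, p h * f h ≤ c := by
  calc ∑ h, p h * f h ≤ ∑ h, p h * c := by
        refine Finset.sum_le_sum fun h _ => ?_
        by_cases hh : h ∈ H
        · exact mul_le_mul_of_nonneg_left (hf h hh) (hp.nonneg h)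
        · simp [hp.support h hh]
    _ = c := by rw [← Finset.sum_mul, hp.total, one_mul]

/-- Jensen's inequality for the square, from the nonnegativity of the variance. -/
theorem IsDistributionOn.sq_sum_mul_le (hp : IsDistributionOn H p) (f : (Cube n → ℤˣ) → ℝ) :
    (∑ h, p h * f h) ^ 2 ≤ ∑ h, p h * f h ^ 2 := by
  have h1 : 0 ≤ ∑ h, p h * (f h - ∑ g, p g * f g) ^ 2 :=
    Finset.sum_nonneg fun h _ => mul_nonneg (hp.nonneg h) (sq_nonneg _)
  set m := ∑ g, p g * f g with hm
  clear_value m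
  have h2 : ∑ h, p h * (f h - m) ^ 2 =
      ∑ h, p h * f h ^ 2 - 2 * m * ∑ h, p h * f h + m ^ 2 * ∑ h, p h := by
    rw [Finset.mul_sum, Finset.mul_sum, ← Finset.sum_sub_distrib, ← Finset.sum_add_distrib]
    exact Finset.sum_congr rfl fun h _ => by ring
  rw [← hm, hp.total] at h2
  linarith

theorem IsDistributionOn.fourier_tail_le (hp : IsDistributionOn H p)
    (hH : ∀ h ∈ H, IsHalfspace h) {a : ℕ} (ha : 0 < a) :
    ∑ S with ¬ S.card < a, (∑ h, p h * fourier (fun x => toReal (h x)) S) ^ 2 ≤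
      3 / Real.sqrt a := by
  refine (Finset.sum_le_sum fun S _ => hp.sq_sum_mul_le _).trans ?_
  rw [Finset.sum_comm]
  simp_rw [← Finset.mul_sum]
  exact hp.sum_mul_le fun h hh => (hH h hh).fourier_tail_le ha

theorem IsDistributionOn.expectedDiameter_eq (hp : IsDistributionOn H p) :
    expectedDiameter p = (1 - expectedInner p) / 2 := by
  have hd : ∀ f g : Cube n → ℤˣ, dist f g = (1 - innerProd f g) / 2 := fun f g => by
    rw [dist, innerProd, ← Finset.sum_div, Finset.sum_sub_distrib]
    simp only [Finset.sum_const, Finset.card_univ, card_cube, nsmul_eq_mul, Nat.cast_pow,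
      Nat.cast_ofNat]
    field_simp
  have h1 : ∑ h₁, ∑ h₂, p h₁ * p h₂ = 1 := by
    rw [← Finset.sum_mul_sum, hp.total, one_mul]
  rw [expectedDiameter, expectedInner, ← h1]
  simp_rw [hd, ← Finset.sum_sub_distrib, Finset.sum_div]
  exact Finset.sum_congr rfl fun _ _ => Finset.sum_congr rfl fun _ _ => by ring

/-! ### Accuracy of the estimator -/

/-- Each consistent `h` gives the same labels on `X`, so one empirical value is `δ`-close to every
`ĥ(S)`, hence to their mean. No knowledge of `p` is needed. -/
theorem Representative.abs_empirical_sub_le {δ : ℝ} {X : Fin k → Cube n} {y : Fin k → ℤˣ}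
    (hX : Representative δ X) (hp : IsDistributionOn (consistent (X, y)) p) (S : Finset (Fin n)) :
    |empirical (X, y) S - ∑ h, p h * fourier (fun x => toReal (h x)) S| ≤ δ := by
  have e : empirical (X, y) S - ∑ h, p h * fourier (fun x => toReal (h x)) S =
      ∑ h, p h * (empirical (X, y) S - fourier (fun x => toReal (h x)) S) := by
    simp_rw [mul_sub, Finset.sum_sub_distrib, ← Finset.sum_mul]
    rw [hp.total, one_mul]
  rw [e]
  refine (Finset.abs_sum_le_sum_abs _ _).trans ?_
  simp_rw [abs_mul, abs_of_nonneg (hp.nonneg _)]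
  refine hp.sum_mul_le fun h hh => ?_
  have hy : y = fun i => h (X i) := funext fun i => (hh.2 i).symm
  rw [hy]
  exact hX h hh.1 S

/-- Bound `n.choose t` by `n ^ t`; the geometric sum below exponent `a` stays under `n ^ a` when the
base is at least `2`. -/
theorem card_filter_card_lt_le (hn : 2 ≤ n) (a : ℕ) :
    (Finset.univ.filter fun S : Finset (Fin n) => S.card < a).card ≤ n ^ a := by
  have h : (Finset.univ.filter fun S : Finset (Fin n) => S.card < a) =
      (Finset.range a).biUnion fun t => Finset.univ.powersetCard t := by
    ext S
    simp
  rw [h]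
  refine (Finset.card_biUnion_le.trans (Finset.sum_le_sum fun t _ => ?_)).trans
    (Nat.geomSum_lt hn fun t ht => Finset.mem_range.1 ht).le
  rw [Finset.card_powersetCard, Finset.card_univ, Fintype.card_fin]
  exact Nat.choose_le_pow n t

theorem Representative.abs_estimator_sub_le {δ : ℝ} {X : Fin k → Cube n} {y : Fin k → ℤˣ}
    (hX : Representative δ X) (hp : IsDistributionOn (consistent (X, y)) p) (h0 : 0 ≤ δ)
    (h1 : δ ≤ 1) (hn : 2 ≤ n) (a : ℕ) :
    |estimator a (X, y) - ∑ S with S.card < a, (∑ h, p h * fourier (fun x => toReal (h x)) S) ^ 2| ≤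
      3 * (n ^ a * δ) := by
  rw [estimator, ← Finset.sum_sub_distrib]
  refine (Finset.abs_sum_le_sum_abs _ _).trans ?_
  have hS : ∀ S, |empirical (X, y) S ^ 2 - (∑ h, p h * fourier (fun x => toReal (h x)) S) ^ 2| ≤
      3 * δ := fun S => by
    have e1 := hX.abs_empirical_sub_le hp S
    have e2 : |∑ h, p h * fourier (fun x => toReal (h x)) S| ≤ 1 := by
      refine (Finset.abs_sum_le_sum_abs _ _).trans ?_
      simp_rw [abs_mul, abs_of_nonneg (hp.nonneg _)]
      exact hp.sum_mul_le fun h _ => abs_fourier_le _ (fun x => (abs_toReal _).le) S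
    set F := ∑ h, p h * fourier (fun x => toReal (h x)) S
    set l := empirical (X, y) S
    -- From `|l - F| ≤ δ ≤ 1` and `|F| ≤ 1`; it is the other factor of `l² - F²`.
    have e3 : |l + F| ≤ 3 := by
      have : l + F = (l - F) + 2 * F := by ring
      rw [this]
      refine (abs_add_le _ _).trans ?_
      rw [abs_mul, abs_two]
      linarith
    rw [sq_sub_sq, abs_mul]
    exact mul_le_mul e3 e1 (abs_nonneg _) (by norm_num)
  refine (Finset.sum_le_sum fun S _ => hS S).trans ?_
  rw [Finset.sum_const, nsmul_eq_mul, mul_left_comm]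
  have : ((Finset.univ.filter fun S : Finset (Fin n) => S.card < a).card : ℝ) ≤ n ^ a := by
    exact_mod_cast card_filter_card_lt_le hn a
  gcongr

theorem Representative.estimator_bounds {δ : ℝ} {X : Fin k → Cube n} {y : Fin k → ℤˣ}
    (hX : Representative δ X) (hp : IsDistributionOn (consistent (X, y)) p) (h0 : 0 ≤ δ)
    (h1 : δ ≤ 1) (hn : 2 ≤ n) {a : ℕ} (ha : 0 < a) :
    expectedInner p - 3 * concentration (consistent (X, y)) p / Real.sqrt a - 3 * (n ^ a * δ) ≤
        estimator a (X, y) ∧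
      estimator a (X, y) ≤ expectedInner p + 3 * (n ^ a * δ) := by
  have e1 := abs_le.1 (hX.abs_estimator_sub_le hp h0 h1 hn a)
  have e2 := hp.fourier_tail_le (fun h hh => hh.1) ha
  have e3 := Finset.sum_filter_add_sum_filter_not (Finset.univ : Finset (Finset (Fin n)))
    (fun S => S.card < a) (fun S => (∑ h, p h * fourier (fun x => toReal (h x)) S) ^ 2)
  rw [← expectedInner_eq_sum_sq] at e3
  have e4 : 0 ≤ ∑ S : Finset (Fin n) with ¬ S.card < a,
      (∑ h, p h * fourier (fun x => toReal (h x)) S) ^ 2 :=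
    Finset.sum_nonneg fun _ _ => sq_nonneg _
  have e5 : 3 / Real.sqrt a ≤ 3 * concentration (consistent (X, y)) p / Real.sqrt a := by
    gcongr
    linarith [hp.one_le_concentration]
  constructor <;> linarith [e1.1, e1.2]

open Filter Topology in
-- Stated for every `Q` implied by the two-sided bound, so that it serves both approximation claims.
theorem exists_forMostDatasets {a : ℕ} (ha : 0 < a) {lam κ : ℝ} (hl : 0 < lam) (hκ : 0 < κ) :
    ∃ N : ℕ, ∀ n k : ℕ, N ≤ n → κ * (n : ℝ) ^ (2 * (a : ℝ) + 2 + lam) ≤ (k : ℝ) →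
      ∀ Q : Dataset n k → Prop, (∀ D, (∀ p, IsDistributionOn (consistent D) p →
          expectedInner p - 3 * concentration (consistent D) p / Real.sqrt a -
              3 * (n : ℝ) ^ (-(lam / 4)) ≤ estimator a D ∧
            estimator a D ≤ expectedInner p + 3 * (n : ℝ) ^ (-(lam / 4))) → Q D) →
        ForMostDatasets n k Q := by
  have hlim : Tendsto (fun n : ℕ => (n : ℝ) ^ (lam / 2)) atTop atTop :=
    (tendsto_rpow_atTop (by positivity)).comp tendsto_natCast_atTop_atTop
  obtain ⟨N, hN⟩ := eventually_atTop.1 (hlim.eventually_ge_atTop (160 / κ))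
  refine ⟨max N 2, fun n k hn hk Q hQ => ?_⟩
  have hn2 : 2 ≤ n := le_of_max_le_right hn
  have hn0 : (0 : ℝ) < n := by positivity
  have hn1 : (1 : ℝ) ≤ n := by exact_mod_cast (by omega : 1 ≤ n)
  have hpow := hN n (le_of_max_le_left hn)
  rw [div_le_iff₀ hκ] at hpow
  -- The surplus `n ^ lam` is shared: `n ^ a * δ = n ^ (-lam/4)` tends to `0`, while `k δ² ≥ κ n ^
  -- (2 + lam/2)` eventually exceeds `160 n²`.
  set δ : ℝ := (n : ℝ) ^ (-(a + lam / 4)) with hδ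
  have hδ0 : 0 ≤ δ := by positivity
  have hδ1 : δ ≤ 1 := Real.rpow_le_one_of_one_le_of_nonpos hn1 (by
    have : (0 : ℝ) ≤ a := Nat.cast_nonneg a
    linarith)
  have herr : (n : ℝ) ^ a * δ = (n : ℝ) ^ (-(lam / 4)) := by
    rw [hδ, ← Real.rpow_natCast, ← Real.rpow_add hn0]
    congr 1; ring
  refine .of_representative hδ0 hδ1 hn2 ?_ fun X y hX _ => hQ _ fun p hp => ?_
  · have e : (n : ℝ) ^ (2 * (a : ℝ) + 2 + lam) * δ ^ 2 = (n : ℝ) ^ 2 * (n : ℝ) ^ (lam / 2) := by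
      rw [hδ, ← Real.rpow_natCast _ 2, ← Real.rpow_mul hn0.le, ← Real.rpow_add hn0,
        ← Real.rpow_natCast _ 2, ← Real.rpow_add hn0]
      congr 1; push_cast; ring
    calc 160 * (n : ℝ) ^ 2 ≤ ((n : ℝ) ^ (lam / 2) * κ) * (n : ℝ) ^ 2 := by gcongr
      _ = κ * (n : ℝ) ^ (2 * (a : ℝ) + 2 + lam) * δ ^ 2 := by rw [mul_assoc κ, e]; ring
      _ ≤ k * δ ^ 2 := by gcongr
  · rw [← herr]
    exact hX.estimator_bounds hp hδ0 hδ1 hn2 ha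

open Filter Topology in
theorem tendsto_error {lam : ℝ} (hl : 0 < lam) :
    Tendsto (fun n : ℕ => 3 * (n : ℝ) ^ (-(lam / 4))) atTop (𝓝 0) := by
  have := (tendsto_rpow_neg_atTop (by positivity : 0 < lam / 4)).comp
    (tendsto_natCast_atTop_atTop (R := ℝ))
  simpa using this.const_mul 3

/-! ### The uniform distribution -/

theorem uniformOn_spec (hH : H.Nonempty) :
    IsDistributionOn H (uniformOn H) ∧ concentration H (uniformOn H) = 1 := by
  classical
  have hc : (H.ncard : ℝ) ≠ 0 := by
    rw [Nat.cast_ne_zero, Ne, Set.ncard_eq_zero (Set.toFinite _)]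
    exact hH.ne_empty
  have hsum : ∀ c : ℝ, ∑ h, (if h ∈ H then c else 0) = H.ncard * c := fun c => by
    rw [← Finset.sum_filter, Finset.sum_const, nsmul_eq_mul, Set.ncard_eq_toFinset_card',
      Set.toFinset]
    congr 3
    ext h
    simp
  refine ⟨⟨fun h => ?_, fun h hh => if_neg hh, ?_⟩, ?_⟩
  · unfold uniformOn
    split_ifs <;> positivity
  · unfold uniformOn
    rw [hsum, mul_one_div_cancel hc]
  · unfold concentration uniformOn
    simp_rw [ite_pow, zero_pow two_ne_zero]
    rw [hsum]
    field_simp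

end ExpectedDiameter

/-! ### Choice of constants and assembly -/

open ExpectedDiameter Filter Topology
theorem mainTheorem1 :
    -- approximation of the expected inner product by the estimator
    (∃ C : ℝ, 0 < C ∧ ∀ (a : ℕ) (lam κ : ℝ), 0 < a → 0 < lam → 0 < κ →
      ∃ err : ℕ → ℝ, Tendsto err atTop (𝓝 0) ∧
        ∃ N : ℕ, ∀ n k : ℕ, N ≤ n → κ * (n : ℝ) ^ (2 * (a : ℝ) + 2 + lam) ≤ (k : ℝ) →
          ForMostDatasets n k (fun D => ∀ p, IsDistributionOn (consistent D) p →
            expectedInner p - C * concentration (consistent D) p / Real.sqrt a - err n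
                ≤ estimator a D ∧
              estimator a D ≤ expectedInner p + err n)) ∧
    -- polynomial-time estimation to constant precision when `c` is bounded by a constant
    (∀ c ε : ℝ, 0 < c → 0 < ε → ∃ a : ℕ, 0 < a ∧
      (∃ (P : Prog) (T : Polynomial ℕ), ComputesWithin P T (fun _ _ D => estimator a D)) ∧
      ∀ lam κ : ℝ, 0 < lam → 0 < κ →
        ∃ N : ℕ, ∀ n k : ℕ, N ≤ n → κ * (n : ℝ) ^ (2 * (a : ℝ) + 2 + lam) ≤ (k : ℝ) →
          ForMostDatasets n k (fun D => ∀ p, IsDistributionOn (consistent D) p →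
            concentration (consistent D) p ≤ c →
              |estimator a D - expectedInner p| ≤ ε ∧
                |(1 - estimator a D) / 2 - expectedDiameter p| ≤ ε)) ∧
    -- the uniform distribution has `c = 1`
    (∀ (n k : ℕ) (D : Dataset n k), (consistent D).Nonempty →
      IsDistributionOn (consistent D) (uniformOn (consistent D)) ∧
        concentration (consistent D) (uniformOn (consistent D)) = 1) := by
  refine ⟨⟨3, by norm_num, fun a lam κ ha hl hκ => ?_⟩, fun c ε hc hε => ?_,
    fun n k D hD => uniformOn_spec hD⟩
  · obtain ⟨N, hN⟩ := exists_forMostDatasets ha hl hκ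
    exact ⟨_, tendsto_error hl, N, fun n k hn hk => hN n k hn hk _ fun D hD => hD⟩
  -- This `a` makes the truncation error `3c/√a` at most `ε/2`; the other half of `ε` is left for
  -- the sampling error.
  · obtain ⟨a, ha⟩ := exists_nat_gt ((6 * c / ε) ^ 2)
    have ha0 : (0 : ℝ) < a := (sq_nonneg _).trans_lt ha
    have hapos : 0 < a := by exact_mod_cast ha0
    have hr : 0 < Real.sqrt a := Real.sqrt_pos.2 ha0
    have hca : 3 * c / Real.sqrt a ≤ ε / 2 := by
      have h1 : 6 * c / ε ≤ Real.sqrt a := Real.le_sqrt_of_sq_le ha.le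
      rw [div_le_iff₀ hε] at h1
      rw [div_le_iff₀ hr]
      linarith
    refine ⟨a, hapos, exists_computesWithin_estimator hapos, fun lam κ hl hκ => ?_⟩
    obtain ⟨N, hN⟩ := exists_forMostDatasets hapos hl hκ
    obtain ⟨N', hN'⟩ := eventually_atTop.1
      ((tendsto_error hl).eventually_le_const (by positivity : 0 < ε / 2))
    refine ⟨max N N', fun n k hn hk => hN n k (le_of_max_le_left hn) hk _
      fun D hD p hp hcp => ?_⟩
    have herr := hN' n (le_of_max_le_right hn)
    obtain ⟨b1, b2⟩ := hD p hp
    have hcc : 3 * concentration (consistent D) p / Real.sqrt a ≤ 3 * c / Real.sqrt a := by gcongr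
    have habs : |estimator a D - expectedInner p| ≤ ε := abs_le.2 ⟨by linarith, by linarith⟩
    refine ⟨habs, ?_⟩
    -- The diameter is `(1 - E ⟨h₁, h₂⟩) / 2`, so its error is half that of the inner product.
    rw [hp.expectedDiameter_eq]
    rw [abs_le] at habs ⊢
    constructor <;> linarith [habs.1, habs.2]
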